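/- For a field $K$ of characteristic $0$ and $n\ge 1$, let $\mu_n$ be the group of $n$-th roots of unity in an algebraic closure of $K$, and regard $\mathrm{Gal}(K(\mu_n)/K)$ as a subgroup of $(\mathbb{Z}/n)^\times$ by identifying an automorphism $\gamma$ with the class $a+n\mathbb{Z}$ such that $\gamma(\zeta)=\zeta^a$ for all $\zeta\in\mu_n$. Let $G$ be a finite group. Two elements $g,h\in G$ are $K$-$\mathrm{Aut}(G)$-conjugate if they have the same order $n$ and $g=\alpha(h^a)$ for some $\alpha\in\mathrm{Aut}(G)$ and some $a+n\mathbb{Z}\in\mathrm{Gal}(K(\mu_n)/K)$; this is an equivalence relation on $G$. Put \[ N_G=\#\{\mathbb{R}\text{-}\mathrm{Aut}(G)\text{-conjugacy classes in }G\}-\#\{\mathbb{Q}\text{-}\mathrm{Aut}(G)\text{-conjugacy classes in }G\}. \] Then every group $G$ of order at most $54$ satisfies $N_G=0$. Moreover, there is, up to isomorphism, exactly one nonabelian group $G_0$ of order $55$, and it is the smallest group with $N_G>0$: one has $N_{G_0}>0$, and every finite group $H$ with $N_H>0$ has order at least $55$ and is isomorphic to $G_0$ if its order is $55$. -/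

import Mathlib

universe u

/-- The class `a + nℤ` belongs to `Gal(K(μ_n)/K)`, regarded as a subgroup of `(ℤ/n)ˣ`: some
automorphism of `K(μ_n)` over `K` sends every `n`-th root of unity `ζ` to `ζ ^ a`. -/
def IsGaloisExponent (K : Type*) [Field K] (n : ℕ) (a : ℤ) : Prop :=
  ∃ σ : CyclotomicField n K ≃ₐ[K] CyclotomicField n K,
    ∀ ζ : CyclotomicField n K, ζ ^ n = 1 → σ ζ = ζ ^ a

/-- For a group `A` of automorphisms of `G`, the elements `g` and `h` are `K`-`A`-conjugate if
they have the same order `n` and `g` lies in the `A`-orbit of `h ^ a` for some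
`a + nℤ ∈ Gal(K(μ_n)/K)`. -/
def IsFieldConj (K : Type*) [Field K] {G : Type*} [Group G] (A : Subgroup (MulAut G))
    (g h : G) : Prop :=
  orderOf g = orderOf h ∧
    ∃ a : ℤ, IsGaloisExponent K (orderOf h) a ∧ ∃ α ∈ A, g = α (h ^ a)

theorem IsGaloisExponent.one (K : Type*) [Field K] (n : ℕ) : IsGaloisExponent K n 1 :=
  ⟨AlgEquiv.refl, fun ζ _ => by simp⟩

theorem IsGaloisExponent.mul {K : Type*} [Field K] {n : ℕ} {a b : ℤ}
    (ha : IsGaloisExponent K n a) (hb : IsGaloisExponent K n b) :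
    IsGaloisExponent K n (a * b) := by
  obtain ⟨σ, hσ⟩ := ha
  obtain ⟨τ, hτ⟩ := hb
  refine ⟨τ.trans σ, fun ζ hζ => ?_⟩
  rw [AlgEquiv.trans_apply, hτ ζ hζ, map_zpow₀, hσ ζ hζ, zpow_mul]

theorem IsGaloisExponent.exists_inv {K : Type*} [Field K] [CharZero K] {n : ℕ} (hn : n ≠ 0)
    {a : ℤ} (ha : IsGaloisExponent K n a) :
    ∃ b : ℤ, IsGaloisExponent K n b ∧ (n : ℤ) ∣ a * b - 1 := by
  obtain ⟨σ, hσ⟩ := ha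
  have : NeZero n := ⟨hn⟩
  have : NeZero (n : K) := ⟨Nat.cast_ne_zero.mpr hn⟩
  have hz := IsCyclotomicExtension.zeta_spec n K (CyclotomicField n K)
  set z := IsCyclotomicExtension.zeta n K (CyclotomicField n K)
  have hz0 : z ≠ 0 := hz.ne_zero hn
  have h1 : (σ.symm z) ^ n = 1 := by rw [← map_pow, hz.pow_eq_one, map_one]
  obtain ⟨i, -, hi⟩ := hz.eq_pow_of_pow_eq_one h1
  refine ⟨i, ⟨σ.symm, fun ζ hζ => ?_⟩, ?_⟩
  · obtain ⟨j, -, rfl⟩ := hz.eq_pow_of_pow_eq_one hζ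
    rw [map_pow, ← hi, zpow_natCast, ← pow_mul, ← pow_mul, mul_comm]
  · rw [← hz.zpow_eq_one_iff_dvd, zpow_sub_one₀ hz0, zpow_mul, ← hσ z hz.pow_eq_one,
      zpow_natCast, ← map_pow, hi, AlgEquiv.apply_symm_apply, mul_inv_cancel₀ hz0]

/-- `K`-`A`-conjugacy is an equivalence relation on a finite group. -/
theorem isFieldConj_equivalence (K : Type*) [Field K] [CharZero K] {G : Type*} [Group G]
    [Finite G] (A : Subgroup (MulAut G)) : Equivalence (IsFieldConj K A) where
  refl g := ⟨rfl, 1, IsGaloisExponent.one K _, 1, A.one_mem, by simp⟩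
  symm := by
    rintro g h ⟨ho, a, ha, α, hα, rfl⟩
    obtain ⟨b, hb, hab⟩ := ha.exists_inv (orderOf_pos h).ne'
    refine ⟨ho.symm, b, by rwa [ho], α⁻¹, A.inv_mem hα, ?_⟩
    rw [← map_zpow, MulAut.inv_apply_self, ← zpow_mul]
    have h1 := orderOf_dvd_iff_zpow_eq_one.mp hab
    rwa [zpow_sub_one, mul_inv_eq_one, eq_comm] at h1
  trans := by
    rintro g h k ⟨ho, a, ha, α, hα, rfl⟩ ⟨ho', b, hb, β, hβ, rfl⟩
    refine ⟨ho.trans ho', b * a, hb.mul (ho' ▸ ha), α * β, A.mul_mem hα hβ, ?_⟩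
    rw [MulAut.mul_apply, zpow_mul, map_zpow β (k ^ b)]

/-- The relation of `K`-`A`-conjugacy on a finite group. -/
def fieldConjSetoid (K : Type*) [Field K] [CharZero K] (G : Type*) [Group G] [Finite G]
    (A : Subgroup (MulAut G)) : Setoid G :=
  ⟨IsFieldConj K A, isFieldConj_equivalence K A⟩

/-- The number of `K`-`A`-conjugacy classes of elements of `G`. -/
noncomputable def numFieldConjClasses (K : Type*) [Field K] [CharZero K] (G : Type*) [Group G]
    [Finite G] (A : Subgroup (MulAut G)) : ℕ :=
  Nat.card (Quotient (fieldConjSetoid K G A))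

/-- The number `N_G` of `ℝ`-`Aut(G)`-conjugacy classes minus the number of
`ℚ`-`Aut(G)`-conjugacy classes of elements of `G`. -/
noncomputable def conjClassDefect (G : Type*) [Group G] [Finite G] : ℤ :=
  (numFieldConjClasses ℝ G ⊤ : ℤ) - (numFieldConjClasses ℚ G ⊤ : ℤ)

/-! Over `ℚ` every exponent coprime to the order is a Galois exponent, while over `ℝ` complex
conjugation provides `-1`. So `N_G = 0` as soon as every `g` can be carried by an automorphism to `g
^ a` or `g ^ (-a)` for each `a` coprime to its order (`PowConj`, `conjClassDefect_eq_zero`).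

For groups of order at most `54` this is proved one element at a time, according to the order `n` of
`g` and the index of `zpowers g`, whose product is the group order. Automorphisms come from four
sources. The transfer cocycle into an abelian normal subgroup `N` yields one acting on `N` as a
power map with exponent `1 + k * N.index` (`exists_mulAut_zpow_mul`, `powConj_of_mem`). The transfer
into the center makes suitable power maps of the whole group automorphic (`powConj_of_center`). A
subgroup of index two together with a central involution gives a twist sending `g` to `g` times that
involution (`exists_mulAut_of_index_two`). Finally there are inner automorphisms. The normal
subgroups and central elements needed are found from the action of `g` on the cosets of `zpowers g`:
an orbit away from the base coset has length dividing `n` and smaller than the index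
(`pow_mem_normalCore`). If one orbit fills all other cosets, the coset action is 2-transitive and
`zpowers g` is maximal (`eq_top_of_period`). The delicate pairs (order, index) are (12,4), (8,6),
(9,6), (5,6) and (16,3).

In a nonabelian group of order `55`, let `y` have order `5` and act on the normal subgroup of order
`11` by cubing. Every automorphism preserves this action, which pins down `y` modulo that subgroup
(`IsFrobeniusPair.apply_ne`); so `y` and `y ^ 2` are rationally conjugate but not really conjugate.
Uniqueness holds because the elements of order `5` in `(ℤ/11)ˣ` are powers of one another
(`exists_isFrobeniusPair`). Abelian groups have `N_G = 0`, so only the nonabelian group of order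
`55` survives. -/

/-! ### Galois exponents over the rational and the real numbers -/

theorem IsGaloisExponent.isCoprime {K : Type*} [Field K] [CharZero K] {n : ℕ} (hn : n ≠ 0)
    {a : ℤ} (ha : IsGaloisExponent K n a) : IsCoprime a n := by
  obtain ⟨b, -, c, hc⟩ := ha.exists_inv hn
  exact ⟨b, -c, by linarith⟩

theorem isGaloisExponent_of_irreducible_cyclotomic {K : Type*} [Field K] [CharZero K] {n : ℕ}
    (hn : n ≠ 0) (irr : Irreducible (Polynomial.cyclotomic n K)) {a : ℤ} (ha : IsCoprime a n) :
    IsGaloisExponent K n a := by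
  have : NeZero n := ⟨hn⟩
  have : NeZero (n : K) := ⟨Nat.cast_ne_zero.mpr hn⟩
  have hz := IsCyclotomicExtension.zeta_spec n K (CyclotomicField n K)
  set z := IsCyclotomicExtension.zeta n K (CyclotomicField n K)
  let u : (ZMod n)ˣ := ZMod.unitOfIsCoprime a ha
  refine ⟨(IsCyclotomicExtension.autEquivPow (CyclotomicField n K) irr).symm u, fun ζ hζ => ?_⟩
  have hu : z ^ (u : ZMod n).val = z ^ a := by
    rw [← zpow_natCast, ← mul_inv_eq_one₀ (zpow_ne_zero _ (hz.ne_zero hn)),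
      ← zpow_neg, ← zpow_add₀ (hz.ne_zero hn), hz.zpow_eq_one_iff_dvd,
      ← ZMod.intCast_zmod_eq_zero_iff_dvd]
    simp [u]
  obtain ⟨j, -, rfl⟩ := hz.eq_pow_of_pow_eq_one hζ
  have h1 : (IsCyclotomicExtension.autEquivPow (CyclotomicField n K) irr).symm u z
      = z ^ (u : ZMod n).val := by
    have h2 := hz.autToPow_spec K
      ((IsCyclotomicExtension.autEquivPow (CyclotomicField n K) irr).symm u)
    have h3 : hz.autToPow K
      ((IsCyclotomicExtension.autEquivPow (CyclotomicField n K) irr).symm u) = u :=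
      (IsCyclotomicExtension.autEquivPow (CyclotomicField n K) irr).apply_symm_apply u
    rw [h3] at h2
    exact h2.symm
  rw [map_pow, h1, hu, ← zpow_natCast, ← zpow_natCast, zpow_comm]

theorem isGaloisExponent_rat {n : ℕ} (hn : n ≠ 0) {a : ℤ} (ha : IsCoprime a n) :
    IsGaloisExponent ℚ n a :=
  isGaloisExponent_of_irreducible_cyclotomic hn
    (Polynomial.cyclotomic.irreducible_rat (Nat.pos_of_ne_zero hn)) ha

/-- After embedding the cyclotomic field in `ℂ`, complex conjugation restricts to it by normality,
and it inverts numbers of absolute value one. -/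
theorem isGaloisExponent_real_neg_one {n : ℕ} (hn : n ≠ 0) : IsGaloisExponent ℝ n (-1) := by
  have : NeZero n := ⟨hn⟩
  have : NeZero (n : ℝ) := ⟨Nat.cast_ne_zero.mpr hn⟩
  have : FiniteDimensional ℝ (CyclotomicField n ℝ) :=
    IsCyclotomicExtension.finiteDimensional {n} ℝ (CyclotomicField n ℝ)
  let i : CyclotomicField n ℝ →ₐ[ℝ] ℂ := IsAlgClosed.lift
  algebraize [i.toRingHom]
  have : IsScalarTower ℝ (CyclotomicField n ℝ) ℂ := IsScalarTower.of_algebraMap_eq fun x => by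
    exact (i.commutes x).symm
  have : IsGalois ℝ (CyclotomicField n ℝ) :=
    IsCyclotomicExtension.isGalois {n} ℝ (CyclotomicField n ℝ)
  refine ⟨Complex.conjAe.restrictNormal (CyclotomicField n ℝ), fun ζ hζ => i.injective ?_⟩
  have h := Complex.conjAe.restrictNormal_commutes (CyclotomicField n ℝ) ζ
  have hn' : (i ζ) ^ n = 1 := by rw [← map_pow, hζ, map_one]
  have h1 : ‖i ζ‖ = 1 := Complex.norm_eq_one_of_pow_eq_one hn' hn
  change i _ = Complex.conjAe (i ζ) at h
  change i _ = i _
  rw [h, zpow_neg_one, map_inv₀, Complex.inv_eq_conj h1]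
  rfl

/-- For a primitive root `z`, the sum `z + z⁻¹` is real, hence fixed by the automorphism, and this
forces `z ^ a` to be `z` or `z⁻¹`. -/
theorem IsGaloisExponent.real_five {a : ℤ} (ha : IsGaloisExponent ℝ 5 a) :
    (5 : ℤ) ∣ a - 1 ∨ (5 : ℤ) ∣ a + 1 := by
  obtain ⟨σ, hσ⟩ := ha
  have : NeZero ((5 : ℕ) : ℝ) := ⟨by norm_num⟩
  have hz := IsCyclotomicExtension.zeta_spec 5 ℝ (CyclotomicField 5 ℝ)
  set z := IsCyclotomicExtension.zeta 5 ℝ (CyclotomicField 5 ℝ)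
  have hz0 : z ≠ 0 := hz.ne_zero (by norm_num)
  have : FiniteDimensional ℝ (CyclotomicField 5 ℝ) :=
    IsCyclotomicExtension.finiteDimensional {5} ℝ (CyclotomicField 5 ℝ)
  let i : CyclotomicField 5 ℝ →ₐ[ℝ] ℂ := IsAlgClosed.lift
  have hn' : (i z) ^ 5 = 1 := by rw [← map_pow, hz.pow_eq_one, map_one]
  have h1 : ‖i z‖ = 1 := Complex.norm_eq_one_of_pow_eq_one hn' (by norm_num)
  have hr : z + z⁻¹ = algebraMap ℝ _ (2 * (i z).re) := by
    apply i.injective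
    change i _ = i _
    rw [map_add, map_inv₀, Complex.inv_eq_conj h1, i.commutes, Complex.add_conj]
    rfl
  have h2 : z ^ a + (z ^ a)⁻¹ = z + z⁻¹ := by
    rw [← hσ z hz.pow_eq_one, ← map_inv₀, ← map_add, hr, AlgEquiv.commutes]
  have h3 : (z ^ a - z) * (z ^ a * z - 1) = 0 := by
    have := zpow_ne_zero a hz0
    field_simp at h2
    linear_combination h2
  rcases mul_eq_zero.mp h3 with h | h
  · left
    rw [← Nat.cast_ofNat, ← hz.zpow_eq_one_iff_dvd, zpow_sub_one₀ hz0, sub_eq_zero.mp h,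
      mul_inv_cancel₀ hz0]
  · right
    rw [← Nat.cast_ofNat, ← hz.zpow_eq_one_iff_dvd, zpow_add_one₀ hz0, sub_eq_zero.mp h]

/-! ### Comparing the real and the rational classes -/

/-- The automorphism orbit of `g` contains `g ^ a` or `g ^ (-a)`. -/
def PowConj {G : Type*} [Group G] (g : G) (a : ℤ) : Prop :=
  ∃ α : MulAut G, α g = g ^ a ∨ α g = g ^ (-a)

theorem isFieldConj_rat_of_real {G : Type*} [Group G] [Finite G] {A : Subgroup (MulAut G)}
    {g h : G} (H : IsFieldConj ℝ A g h) : IsFieldConj ℚ A g h := by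
  obtain ⟨ho, a, ha, α, hα, h⟩ := H
  exact ⟨ho, a, isGaloisExponent_rat (orderOf_pos _).ne' (ha.isCoprime (orderOf_pos _).ne'),
    α, hα, h⟩

theorem conjClassDefect_eq_zero {G : Type*} [Group G] [Finite G]
    (H : ∀ (g : G) (a : ℤ), IsCoprime a (orderOf g) → PowConj g a) : conjClassDefect G = 0 := by
  have h : fieldConjSetoid ℝ G ⊤ = fieldConjSetoid ℚ G ⊤ := by
    ext g h
    refine ⟨isFieldConj_rat_of_real, ?_⟩
    rintro ⟨ho, a, ha, α, -, rfl⟩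
    have hn := (orderOf_pos h).ne'
    obtain ⟨β, hβ | hβ⟩ := H h a (ha.isCoprime hn)
    · exact ⟨ho, 1, IsGaloisExponent.one ℝ _, α * β, trivial, by simp [hβ]⟩
    · refine ⟨ho, -1, isGaloisExponent_real_neg_one hn, α * β, trivial, ?_⟩
      rw [zpow_neg_one, map_inv, MulAut.mul_apply, hβ]
      simp
  rw [conjClassDefect, numFieldConjClasses, numFieldConjClasses, h, sub_self]

/-- Real classes map onto rational classes, so a single rational class that splits makes the counts
differ. -/
theorem conjClassDefect_pos {G : Type*} [Group G] [Finite G] {g h : G}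
    (hQ : IsFieldConj ℚ ⊤ g h) (hR : ¬ IsFieldConj ℝ ⊤ g h) : 0 < conjClassDefect G := by
  let f : Quotient (fieldConjSetoid ℝ G ⊤) → Quotient (fieldConjSetoid ℚ G ⊤) :=
    Quotient.map id fun _ _ => isFieldConj_rat_of_real
  have hf : Function.Surjective f := by
    rintro ⟨x⟩
    exact ⟨Quotient.mk _ x, rfl⟩
  have hle := Nat.card_le_card_of_surjective f hf
  have hne : Nat.card (Quotient (fieldConjSetoid ℝ G ⊤)) ≠
      Nat.card (Quotient (fieldConjSetoid ℚ G ⊤)) := fun heq => by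
    have hb := (Nat.bijective_iff_surjective_and_card f).mpr ⟨hf, heq⟩
    have h1 : f (Quotient.mk _ g) = f (Quotient.mk _ h) :=
      Quotient.sound (s := fieldConjSetoid ℚ G ⊤) hQ
    exact hR (Quotient.exact (hb.1 h1))
  have := lt_of_le_of_ne hle hne.symm
  simp only [conjClassDefect, numFieldConjClasses]
  omega

/-! ### Automorphisms built from transfer cocycles -/

open scoped IsMulCommutative in
/-- The cocycle with values in an abelian normal subgroup `N` of finite index that restricts to
the `N.index`-th power map on `N`. -/
theorem exists_crossedHom {G : Type*} [Group G] (N : Subgroup G) [N.Normal] [IsMulCommutative N]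
    [N.FiniteIndex] : ∃ τ : G → N, (∀ g h, τ (g * h) = MulAut.conjNormal g (τ h) * τ g) ∧
      ∀ x : N, τ x = x ^ N.index := by
  have := N.fintypeQuotientOfFiniteIndex
  have hmem : ∀ (g : G) (q : G ⧸ N), g * q.out * (g • q).out⁻¹ ∈ N := fun g q => by
    have h1 : (((g • q).out : G) : G ⧸ N) = ((g * q.out : G) : G ⧸ N) := by
      rw [QuotientGroup.out_eq', ← smul_eq_mul, ← MulAction.Quotient.smul_coe,
        QuotientGroup.out_eq']
    have h2 := Subgroup.Normal.conj_mem ‹_› _ (QuotientGroup.eq.mp h1) (g • q).out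
    simpa [mul_assoc] using h2
  refine ⟨fun g => ∏ q : G ⧸ N, ⟨_, hmem g q⟩, fun g h => ?_, fun x => ?_⟩
  · beta_reduce
    -- Reindexing the product for `g` along `q ↦ h • q` makes the cocycle identity hold factor by
    -- factor.
    rw [map_prod, ← Equiv.prod_comp (MulAction.toPerm h : Equiv.Perm (G ⧸ N))
      (fun q => (⟨_, hmem g q⟩ : N)), ← Finset.prod_mul_distrib]
    refine Finset.prod_congr rfl fun q _ => Subtype.ext ?_
    simp [mul_assoc, mul_smul]
  · rw [Subgroup.index_eq_card, Nat.card_eq_fintype_card]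
    refine Finset.prod_eq_pow_card fun q _ => Subtype.ext ?_
    have h1 : (x : G) • q = q := by
      induction q using QuotientGroup.induction_on with
      | H y =>
        rw [MulAction.Quotient.smul_coe, smul_eq_mul, eq_comm, QuotientGroup.eq]
        have := Subgroup.Normal.conj_mem ‹_› _ x.2 y⁻¹
        simpa [mul_assoc] using this
    simp [h1]

-- The `k`-th power of the cocycle `τ` is again a cocycle, so `g ↦ τ g ^ k * g` is an endomorphism.
-- Its kernel lies in `N`, where it is a power map with exponent coprime to the order of `N`.
open scoped IsMulCommutative in
theorem exists_mulAut_zpow_mul {G : Type*} [Group G] [Finite G] (N : Subgroup G) [N.Normal]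
    [IsMulCommutative N] (k : ℤ) (hk : IsCoprime (1 + k * N.index) (Nat.card N : ℤ)) :
    ∃ α : MulAut G, (∀ x ∈ N, α x = x ^ (1 + k * N.index)) ∧ ∀ g, α g * g⁻¹ ∈ N := by
  obtain ⟨τ, hτ, hτN⟩ := exists_crossedHom N
  let f : G →* G := MonoidHom.mk' (fun g => ((τ g ^ k : N) : G) * g) fun g h => by
    have h1 : MulAut.conjNormal g (τ h) * τ g = τ g * MulAut.conjNormal g (τ h) := mul_comm _ _
    rw [hτ, h1, mul_zpow, ← map_zpow]
    simp only [Subgroup.coe_mul, MulAut.conjNormal_apply, mul_assoc, inv_mul_cancel_left]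
  have hfN : ∀ x ∈ N, f x = x ^ (1 + k * N.index) := fun x hx => by
    change ((τ x ^ k : N) : G) * x = _
    rw [hτN ⟨x, hx⟩]
    simp only [Subgroup.coe_zpow, Subgroup.coe_pow]
    rw [← zpow_natCast, ← zpow_mul, add_comm, zpow_add_one, mul_comm]
  have hinj : Function.Injective f := (injective_iff_map_eq_one f).mpr fun g hg => by
    have hgN : g ∈ N := by
      have : g = ((τ g ^ k : N) : G)⁻¹ := (inv_eq_of_mul_eq_one_right hg).symm
      rw [this]
      exact N.inv_mem (τ g ^ k).2
    rw [hfN g hgN] at hg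
    obtain ⟨u, v, huv⟩ := hk
    have h2 : g ^ (Nat.card N : ℤ) = 1 := by
      rw [zpow_natCast]
      exact congrArg Subtype.val (pow_card_eq_one' (x := (⟨g, hgN⟩ : N)))
    rw [← zpow_one g, ← huv, zpow_add, zpow_mul', zpow_mul', hg, h2]
    simp
  refine ⟨MulEquiv.ofBijective f (Finite.injective_iff_bijective.mp hinj), hfN, fun g => ?_⟩
  change ((τ g ^ k : N) : G) * g * g⁻¹ ∈ N
  rw [mul_inv_cancel_right]
  exact (τ g ^ k).2

/-- If `N` has odd order, the automorphism can be chosen to fix a given involution. -/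
theorem exists_mulAut_zpow_fix {G : Type*} [Group G] [Finite G] (N : Subgroup G) [N.Normal]
    [IsMulCommutative N] (hN : Odd (Nat.card N)) {h : G} (hh : h ^ 2 = 1) (k : ℤ)
    (hk : IsCoprime (1 + k * N.index) (Nat.card N : ℤ)) :
    ∃ α : MulAut G, (∀ x ∈ N, α x = x ^ (1 + k * N.index)) ∧ α h = h := by
  obtain ⟨α, hα, hαN⟩ := exists_mulAut_zpow_mul N k hk
  obtain ⟨j, hj⟩ := hN
  set c := α h * h⁻¹ with hc
  have hαh : α h = c * h := by simp [hc]
  have hcN : c ∈ N := hαN h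
  -- Since `α h = c * h` also squares to one, `h` inverts `c`.
  have hinv : h * c * h⁻¹ = c⁻¹ := by
    have h1 : (c * h) * (c * h) = 1 := by rw [← hαh, ← map_mul, ← pow_two, hh, map_one]
    have h2 : h⁻¹ = h := inv_eq_of_mul_eq_one_right (by rw [← pow_two, hh])
    rw [h2, ← mul_eq_one_iff_eq_inv'.mp (by simpa [mul_assoc] using h1)]
    simp [mul_assoc]
  have hcard : c ^ (2 * j + 1) = 1 := by
    rw [← hj]
    exact congrArg Subtype.val (pow_card_eq_one' (x := (⟨c, hcN⟩ : N)))
  -- As `h` inverts `c`, conjugation by `c ^ j` turns `c * h` into `c ^ (2 * j + 1) * h = h`; on the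
  -- abelian subgroup `N` it is trivial.
  refine ⟨MulAut.conj (c ^ j) * α, fun x hx => ?_, ?_⟩
  · rw [MulAut.mul_apply, hα x hx, MulAut.conj_apply, mul_inv_eq_iff_eq_mul]
    exact setLike_mul_comm (N.pow_mem hcN j) (N.zpow_mem hx _)
  · rw [MulAut.mul_apply, hαh, MulAut.conj_apply, mul_inv_eq_iff_eq_mul]
    have h3 : h * c ^ j = (c ^ j)⁻¹ * h := by
      rw [← mul_inv_eq_iff_eq_mul, ← conj_pow, hinv, inv_pow]
    rw [h3, eq_inv_mul_iff_mul_eq, ← mul_assoc, ← mul_assoc, ← pow_add, ← pow_succ, ← two_mul,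
      hcard, one_mul]

/-- Bézout solves the congruence modulo `n`. The solution is a unit modulo `n * m`, and units lift
along `ℤ/(n * m * c) → ℤ/(n * m)`; a lift is still `1` modulo `m` and is coprime to `c`. -/
theorem exists_modEq_isCoprime {n m c : ℕ} (hn : n ≠ 0) (hm : m ≠ 0) (hc : c ≠ 0) {a : ℤ}
    (ha : IsCoprime a n) (h : a ≡ 1 [ZMOD (Nat.gcd n m : ℕ)]) :
    ∃ k : ℤ, 1 + k * m ≡ a [ZMOD n] ∧ IsCoprime (1 + k * m) (c : ℤ) := by
  obtain ⟨u, v, huv⟩ : ∃ u v : ℤ, 1 + u * m = a + v * n := by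
    obtain ⟨d, hd⟩ := h.dvd
    have hb := Nat.gcd_eq_gcd_ab n m
    refine ⟨-(d * n.gcdB m), d * n.gcdA m, ?_⟩
    rw [hb] at hd
    linear_combination hd
  have h1 : IsCoprime (1 + u * m) ((n : ℤ) * m) := by
    refine IsCoprime.mul_right ?_ ?_
    · rw [huv]; exact ha.add_mul_right_left v
    · exact isCoprime_one_left.add_mul_right_left u
  have hcop : IsCoprime (1 + u * m) ((n * m : ℕ) : ℤ) := by exact_mod_cast h1
  have : NeZero (n * m * c) := ⟨by positivity⟩
  obtain ⟨w, hw⟩ := ZMod.unitsMap_surjective (Dvd.intro c rfl : n * m ∣ n * m * c)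
    (ZMod.unitOfIsCoprime _ hcop)
  have hw' : ((w : ZMod (n * m * c)).val : ZMod (n * m)) = ((1 + u * m : ℤ) : ZMod (n * m)) := by
    have := congrArg Units.val hw
    rw [ZMod.unitsMap_val, ZMod.cast_eq_val] at this
    exact this
  set b := (w : ZMod (n * m * c)).val
  have hb : IsCoprime (b : ℤ) (c : ℤ) :=
    Nat.isCoprime_iff_coprime.mpr (Nat.Coprime.coprime_dvd_right (Dvd.intro_left _ rfl)
      (ZMod.val_coe_unit_coprime w))
  have hbm : ((n * m : ℕ) : ℤ) ∣ b - (1 + u * m) := by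
    rw [← ZMod.intCast_eq_intCast_iff_dvd_sub]
    push_cast at hw' ⊢
    exact hw'.symm
  obtain ⟨e, he⟩ := hbm
  push_cast at he
  refine ⟨u + n * e, ?_, ?_⟩
  · refine Int.modEq_iff_dvd.mpr ⟨-v - e * m, ?_⟩
    linear_combination -huv
  · rw [show (1 : ℤ) + (u + n * e) * m = b by linear_combination -he]
    exact hb

/-! ### Criteria for power conjugacy -/

theorem zpow_eq_of_modEq {G : Type*} [Group G] {g : G} {a b : ℤ}
    (h : a ≡ b [ZMOD orderOf g]) : g ^ a = g ^ b :=
  zpow_eq_zpow_iff_modEq.mpr h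

theorem PowConj.of_modEq {G : Type*} [Group G] {g : G} {a b : ℤ} (h : PowConj g a)
    (hab : a ≡ b [ZMOD orderOf g] ∨ a ≡ -b [ZMOD orderOf g]) : PowConj g b := by
  obtain ⟨α, hα⟩ := h
  refine ⟨α, ?_⟩
  rcases hab with h | h
  · rwa [← zpow_eq_of_modEq h, ← zpow_eq_of_modEq h.neg]
  · have h2 := h.neg
    rw [neg_neg] at h2
    rwa [← zpow_eq_of_modEq h, ← zpow_eq_of_modEq h2, or_comm]

theorem PowConj.mul {G : Type*} [Group G] {g : G} {a b : ℤ} (ha : PowConj g a)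
    (hb : PowConj g b) : PowConj g (a * b) := by
  obtain ⟨α, hα⟩ := ha
  obtain ⟨β, hβ⟩ := hb
  refine ⟨α * β, ?_⟩
  rw [MulAut.mul_apply]
  rcases hα with h | h <;> rcases hβ with h' | h' <;> rw [h', map_zpow, h, ← zpow_mul] <;> simp

theorem PowConj.pow {G : Type*} [Group G] {g : G} {a : ℤ} (ha : PowConj g a) (j : ℕ) :
    PowConj g (a ^ j) := by
  induction j with
  | zero => exact ⟨1, Or.inl (by simp)⟩
  | succ j ih => rw [pow_succ]; exact ih.mul ha

theorem PowConj.one {G : Type*} [Group G] (g : G) : PowConj g 1 := ⟨1, Or.inl (by simp)⟩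

/-- An element of an abelian normal subgroup is conjugate to its `a`-th power if `a ≡ ±1` modulo
the greatest common divisor of the order and the index. -/
theorem powConj_of_mem {G : Type*} [Group G] [Finite G] (N : Subgroup G) [N.Normal]
    [IsMulCommutative N] {g : G} (hg : g ∈ N) {a : ℤ} (ha : IsCoprime a (orderOf g))
    (h : a ≡ 1 [ZMOD (Nat.gcd (orderOf g) N.index : ℕ)] ∨
      -a ≡ 1 [ZMOD (Nat.gcd (orderOf g) N.index : ℕ)]) : PowConj g a := by
  have key : ∀ b : ℤ, IsCoprime b (orderOf g) → b ≡ 1 [ZMOD (Nat.gcd (orderOf g) N.index : ℕ)] →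
      ∃ α : MulAut G, α g = g ^ b := fun b hb hb1 => by
    obtain ⟨k, hk, hk'⟩ := exists_modEq_isCoprime (orderOf_pos g).ne'
      Subgroup.FiniteIndex.index_ne_zero (Nat.card_pos (α := N)).ne' hb hb1
    obtain ⟨α, hα, -⟩ := exists_mulAut_zpow_mul N k hk'
    exact ⟨α, (hα g hg).trans (zpow_eq_of_modEq hk)⟩
  rcases h with h | h
  · obtain ⟨α, hα⟩ := key a ha h
    exact ⟨α, Or.inl hα⟩
  · obtain ⟨α, hα⟩ := key (-a) ha.neg_left h
    exact ⟨α, Or.inr hα⟩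

/-- The version for a product `x * h` of commuting elements with `x ∈ N` and `h ^ 2 = 1`. -/
theorem powConj_mul_of_mem {G : Type*} [Group G] [Finite G] (N : Subgroup G) [N.Normal]
    [IsMulCommutative N] (hN : Odd (Nat.card N)) {x h : G} (hx : x ∈ N) (hh : h ^ 2 = 1)
    (hxh : Commute x h) {a : ℤ} (ha : IsCoprime a (orderOf x)) (ha2 : Odd a)
    (hg : a ≡ 1 [ZMOD (Nat.gcd (orderOf x) N.index : ℕ)]) : PowConj (x * h) a := by
  obtain ⟨k, hk, hk'⟩ := exists_modEq_isCoprime (orderOf_pos x).ne'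
    Subgroup.FiniteIndex.index_ne_zero (Nat.card_pos (α := N)).ne' ha hg
  obtain ⟨α, hα, hαh⟩ := exists_mulAut_zpow_fix N hN hh k hk'
  obtain ⟨j, rfl⟩ := ha2
  refine ⟨α, Or.inl ?_⟩
  rw [map_mul, hα x hx, zpow_eq_of_modEq hk, hαh, hxh.mul_zpow, zpow_add_one h, zpow_mul]
  rw [show h ^ (2 : ℤ) = 1 from mod_cast hh, one_zpow, one_mul]

open scoped IsMulCommutative in
/-- Power maps with exponent `1` modulo the index of the center are automorphisms. -/
theorem powConj_of_center {G : Type*} [Group G] [Finite G] (g : G) (k : ℤ) {m : ℕ}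
    (hm : (Subgroup.center G).index ∣ m) (hk : IsCoprime (1 + k * m) (Nat.card G : ℤ)) :
    PowConj g (1 + k * m) := by
  obtain ⟨d, rfl⟩ := hm
  -- The transfer into the center is the power map with exponent the index of the center, so
  -- multiplying `x` by a power of its transfer is a homomorphism.
  let f : G →* G := MonoidHom.mk'
    (fun x => ((MonoidHom.transferCenterPow G x ^ (k * d) : Subgroup.center G) : G) * x)
    fun x y => by
      have := ((Subgroup.mem_center_iff.mp (MonoidHom.transferCenterPow G y ^ (k * d)).2) x)
      rw [map_mul, mul_zpow, Subgroup.coe_mul]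
      simp only [mul_assoc]
      rw [← mul_assoc x, this, mul_assoc]
  have hf : ∀ x, f x = x ^ (1 + k * ((Subgroup.center G).index * d : ℕ)) := fun x => by
    change ((MonoidHom.transferCenterPow G x ^ (k * d) : Subgroup.center G) : G) * x = _
    rw [Subgroup.coe_zpow, MonoidHom.transferCenterPow_apply, ← zpow_natCast, ← zpow_mul,
      ← zpow_add_one]
    congr 1
    push_cast
    ring
  have hinj : Function.Injective f := (injective_iff_map_eq_one f).mpr fun x hx => by
    rw [hf] at hx
    obtain ⟨u, v, huv⟩ := hk
    have h2 : x ^ (Nat.card G : ℤ) = 1 := by rw [zpow_natCast, pow_card_eq_one']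
    rw [← zpow_one x, ← huv, zpow_add, zpow_mul', zpow_mul', hx, h2]
    simp
  exact ⟨MulEquiv.ofBijective f (Finite.injective_iff_bijective.mp hinj), Or.inl (hf g)⟩

/-- Multiplying the elements outside a subgroup of index two by a central involution. -/
theorem exists_mulAut_of_index_two {G : Type*} [Group G] (U : Subgroup G)
    (hU : U.index = 2) {c : G} (hc : c ∈ Subgroup.center G) (hc2 : c * c = 1) (hcU : c ∈ U) :
    ∃ α : MulAut G, ∀ g ∉ U, α g = g * c := by
  classical
  have hcomm : ∀ x, x * c = c * x := fun x => (Subgroup.mem_center_iff.mp hc x)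
  let f : G →* G := MonoidHom.mk' (fun x => if x ∈ U then x else x * c) fun x y => by
    simp only [Subgroup.mul_mem_iff_of_index_two hU]
    by_cases hx : x ∈ U <;> by_cases hy : y ∈ U <;> simp only [hx, hy, if_true, if_false, iff_true,
      iff_false, not_true_eq_false, mul_assoc]
    · rw [hcomm y]
    · rw [← mul_assoc c, ← hcomm y, mul_assoc, hc2, mul_one]
  have hff : ∀ x, f (f x) = x := fun x => by
    change (if (if x ∈ U then x else x * c) ∈ U then _ else _) = x
    by_cases hx : x ∈ U
    · simp [hx]
      exact if_pos hx
    · have : x * c ∉ U := by rwa [Subgroup.mul_mem_cancel_right U hcU]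
      simp only [hx, if_false, this]
      change (if x ∈ U then x else x * c) * c = x
      rw [if_neg hx, mul_assoc, hc2, mul_one]
  exact ⟨MulEquiv.mk ⟨f, f, hff, hff⟩ f.map_mul, fun g hg => if_neg hg⟩

/-! ### The action on the cosets of a subgroup -/

section CyclicSubgroups

open Subgroup MulAction

variable {G : Type*} [Group G]

theorem orderOf_conj (x y : G) : orderOf (y * x * y⁻¹) = orderOf x :=
  orderOf_injective (MulAut.conj y).toMonoidHom (MulAut.conj y).injective x

theorem orderOf_mul_index_zpowers (g : G) : orderOf g * (zpowers g).index = Nat.card G := by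
  rw [← Nat.card_zpowers, card_mul_index]

theorem mem_normalCore_iff_smul {H : Subgroup G} {x : G} :
    x ∈ H.normalCore ↔ ∀ q : G ⧸ H, x • q = q := by
  rw [normalCore_eq_ker, MonoidHom.mem_ker, Equiv.Perm.ext_iff]
  rfl

theorem smul_coe_one_of_mem {H : Subgroup G} {g : G} (hg : g ∈ H) :
    g • ((1 : G) : G ⧸ H) = ((1 : G) : G ⧸ H) := by
  rw [Quotient.smul_coe, smul_eq_mul, mul_one, QuotientGroup.eq, mul_one]
  exact inv_mem hg

theorem ncard_orbit_zpowers {α : Type*} [MulAction G α] [Finite α] (g : G) (q : α) :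
    (orbit (zpowers g) q).ncard = period g q := by
  classical
  have := Fintype.ofFinite (orbit (zpowers g) q)
  rw [period_eq_minimalPeriod, minimalPeriod_eq_card, ← Nat.card_eq_fintype_card]
  rfl

theorem mem_center_of_orderOf_eq_two {c : G} [hN : (zpowers c).Normal] (hc : orderOf c = 2) :
    c ∈ center G := by
  rw [mem_center_iff]
  intro y
  obtain ⟨i, hi⟩ := mem_zpowers_iff.mp (hN.conj_mem c (mem_zpowers c) y)
  rw [← zpow_mod_orderOf, hc] at hi
  rcases Int.emod_two_eq_zero_or_one i with h | h
  · have h1 : c = 1 := by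
      rw [Nat.cast_ofNat, h, zpow_zero, eq_comm, conj_eq_one_iff] at hi
      exact hi
    rw [h1, orderOf_one] at hc
    omega
  · rw [Nat.cast_ofNat, h, zpow_one] at hi
    rw [← mul_inv_eq_iff_eq_mul, ← hi]

theorem index_ker_of_ne_one {f : G →* ℤˣ} {g : G} (hg : f g ≠ 1) : f.ker.index = 2 := by
  rw [index_ker]
  have h1 := Subgroup.card_le_card_group f.range
  have h2 : f.range ≠ ⊥ := fun h => hg (by
    rw [← Subgroup.mem_bot, ← h]
    exact ⟨g, rfl⟩)
  rw [← Subgroup.one_lt_card_iff_ne_bot] at h2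
  have h3 : Nat.card ℤˣ = 2 := by simp
  omega

theorem orbit_zpowers_subset {H : Subgroup G} {g : G} (hg : g ∈ H) {q : G ⧸ H}
    (hq : q ≠ ((1 : G) : G ⧸ H)) : orbit (zpowers g) q ⊆ {((1 : G) : G ⧸ H)}ᶜ := by
  rintro _ ⟨⟨x, hx⟩, rfl⟩ h
  apply hq
  have h1 : x • q = ((1 : G) : G ⧸ H) := h
  have hxH : x ∈ H := (zpowers_le.mpr hg) hx
  rw [← smul_coe_one_of_mem hxH] at h1
  exact smul_left_cancel x h1

/-- The element `g ^ (2 * m)` is a central involution, and `g` lies outside the index-two kernel of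
`f`, so the index-two twist sends `g` to `g ^ (1 + 2 * m)`. -/
theorem powConj_of_sign {f : G →* ℤˣ} {g : G} (hf : f g ≠ 1) {m : ℕ}
    (hm : orderOf g = 4 * m) (hc : g ^ (2 * m) ∈ center G) : PowConj g (1 + 2 * m) := by
  obtain ⟨α, hα⟩ := exists_mulAut_of_index_two f.ker (index_ker_of_ne_one hf) hc
    (by rw [← pow_add, ← two_mul, ← mul_assoc]; exact hm ▸ pow_orderOf_eq_one g)
    (by rw [MonoidHom.mem_ker, map_pow, pow_mul, Int.units_sq, one_pow])
  refine ⟨α, Or.inl ?_⟩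
  rw [hα g hf, zpow_add, zpow_one]
  norm_cast

theorem pow_mem_normalCore_of_period {H : Subgroup G} {g : G} (hg : g ∈ H) {e : ℕ}
    (he : ∀ q : G ⧸ H, q ≠ ((1 : G) : G ⧸ H) → period g q ∣ e) : g ^ e ∈ H.normalCore := by
  rw [mem_normalCore_iff_smul]
  intro q
  by_cases hq : q = ((1 : G) : G ⧸ H)
  · rw [hq, smul_coe_one_of_mem (pow_mem hg e)]
  · exact pow_smul_eq_iff_period_dvd.mpr (he q hq)

variable [Finite G]

/-- A finite cyclic group has only one subgroup of each order. -/
theorem mem_zpowers_of_orderOf_dvd {g x y : G} (hx : x ∈ zpowers g) (hy : y ∈ zpowers g)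
    (h : orderOf y ∣ orderOf x) : y ∈ zpowers x := by
  obtain ⟨i, rfl⟩ := (isOfFinOrder_of_finite g).mem_powers_iff_mem_zpowers.mpr hx
  obtain ⟨j, rfl⟩ := (isOfFinOrder_of_finite g).mem_powers_iff_mem_zpowers.mpr hy
  simp only [orderOf_pow] at h
  have h1 : (orderOf g).gcd i ∣ (orderOf g).gcd j := by
    obtain ⟨u, hu⟩ := Nat.gcd_dvd_left (orderOf g) i
    obtain ⟨v, hv⟩ := Nat.gcd_dvd_left (orderOf g) j
    have hn := orderOf_pos g
    have hi := Nat.gcd_pos_of_pos_left i hn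
    have hj := Nat.gcd_pos_of_pos_left j hn
    rw [Nat.div_eq_of_eq_mul_right hi hu, Nat.div_eq_of_eq_mul_right hj hv] at h
    obtain ⟨w, hw⟩ := h
    refine ⟨w, Nat.eq_of_mul_eq_mul_right (Nat.pos_of_ne_zero fun h0 => ?_ : 0 < v) ?_⟩
    · rw [h0, mul_zero] at hv
      omega
    · rw [← hv, mul_assoc, mul_comm w, ← hw, ← hu]
  obtain ⟨c, hc⟩ := h1.trans (Nat.gcd_dvd_right _ j)
  have hd : g ^ ((orderOf g).gcd i : ℤ) = (g ^ i) ^ ((orderOf g).gcdB i) := by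
    rw [Nat.gcd_eq_gcd_ab, zpow_add, zpow_mul, zpow_natCast, pow_orderOf_eq_one, one_zpow, one_mul,
      zpow_mul, zpow_natCast]
  refine ⟨(orderOf g).gcdB i * c, ?_⟩
  simp only
  rw [zpow_mul, ← hd, hc, zpow_natCast, zpow_natCast, pow_mul]

/-- A conjugate of `x` lies in the same cyclic group and has the same order, so it generates the
same subgroup. -/
theorem normal_zpowers_of_mem_normalCore {g x : G} (hx : x ∈ (zpowers g).normalCore) :
    (zpowers x).Normal := by
  refine ⟨?_⟩
  rintro _ ⟨i, rfl⟩ y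
  simp only
  rw [← conj_zpow]
  exact zpow_mem (mem_zpowers_of_orderOf_dvd (normalCore_le _ hx)
    (normalCore_le _ ((normalCore_normal _).conj_mem x hx y)) (orderOf_conj x y).dvd) i

theorem period_lt_index {H : Subgroup G} {g : G} (hg : g ∈ H) {q : G ⧸ H}
    (hq : q ≠ ((1 : G) : G ⧸ H)) : period g q + 1 ≤ H.index := by
  have h := Set.ncard_le_ncard (orbit_zpowers_subset hg hq) (Set.toFinite _)
  have h2 := Set.ncard_add_ncard_compl {((1 : G) : G ⧸ H)}
  rw [Set.ncard_singleton, ← index_eq_card] at h2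
  have h3 : (orbit (zpowers g) q).ncard = period g q := ncard_orbit_zpowers g q
  omega

/-- The base coset is fixed by `g`, so every other orbit has length dividing the order of `g` and
below the index; a common multiple `e` of these candidates gives a power acting trivially. -/
theorem pow_mem_normalCore {H : Subgroup G} {g : G} (hg : g ∈ H) {e : ℕ}
    (he : ∀ d, d ∣ orderOf g → d + 1 ≤ H.index → d ∣ e) : g ^ e ∈ H.normalCore :=
  pow_mem_normalCore_of_period hg fun q hq =>
    he _ (period_dvd_orderOf g q) (period_lt_index hg hq)

theorem exists_pow_smul_of_period {H : Subgroup G} {g : G} (hg : g ∈ H) {q : G ⧸ H}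
    (hq : q ≠ ((1 : G) : G ⧸ H)) (hp : period g q + 1 = H.index) {r : G ⧸ H}
    (hr : r ≠ ((1 : G) : G ⧸ H)) : ∃ x ∈ zpowers g, r = x • q := by
  have h2 := Set.ncard_add_ncard_compl {((1 : G) : G ⧸ H)}
  rw [Set.ncard_singleton, ← index_eq_card] at h2
  have h := Set.eq_of_subset_of_ncard_le (orbit_zpowers_subset hg hq)
    (by have h3 : (orbit (zpowers g) q).ncard = period g q := ncard_orbit_zpowers g q
        omega) (Set.toFinite _)
  have hr' : r ∈ orbit (zpowers g) q := by rw [h]; exact hr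
  obtain ⟨⟨x, hx⟩, rfl⟩ := hr'
  exact ⟨x, hx, rfl⟩

/-- An orbit filling all cosets but the base one makes the coset action 2-transitive, hence `H`
maximal. -/
theorem eq_top_of_period {H M : Subgroup G} {g : G} (hg : g ∈ H) {q : G ⧸ H}
    (hq : q ≠ ((1 : G) : G ⧸ H)) (hp : period g q + 1 = H.index) (hHM : H ≤ M) {y : G}
    (hyM : y ∈ M) (hyH : y ∉ H) : M = ⊤ := by
  have hne : ∀ x : G, x ∉ H → ((x : G) : G ⧸ H) ≠ ((1 : G) : G ⧸ H) := fun x hx h => by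
    rw [eq_comm, QuotientGroup.eq, inv_one, one_mul] at h
    exact hx h
  rw [eq_top_iff]
  intro x _
  by_cases hx : x ∈ H
  · exact hHM hx
  · obtain ⟨u, hu, hu'⟩ := exists_pow_smul_of_period hg hq hp (hne x hx)
    obtain ⟨v, hv, hv'⟩ := exists_pow_smul_of_period hg hq hp (hne y hyH)
    have hle : zpowers g ≤ M := zpowers_le.mpr (hHM hg)
    have h1 : ((u * v⁻¹ * y : G) : G ⧸ H) = x := by
      rw [hu', ← smul_eq_mul, ← Quotient.smul_coe, hv', mul_smul, inv_smul_smul]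
    have h2 := hHM (QuotientGroup.eq.mp h1)
    have h3 : u * v⁻¹ * y ∈ M := mul_mem (mul_mem (hle hu) (inv_mem (hle hv))) hyM
    exact (mul_mem_cancel_left (inv_mem h3)).mp h2

/-- Powers of `g` commute and permute the other cosets transitively, so a power fixing one of them
fixes all. -/
theorem pow_period_mem_normalCore {H : Subgroup G} {g : G} (hg : g ∈ H) {q : G ⧸ H}
    (hq : q ≠ ((1 : G) : G ⧸ H)) (hp : period g q + 1 = H.index) :
    g ^ period g q ∈ H.normalCore := by
  rw [mem_normalCore_iff_smul]
  intro r
  by_cases hr : r = ((1 : G) : G ⧸ H)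
  · rw [hr, smul_coe_one_of_mem (pow_mem hg _)]
  · obtain ⟨x, ⟨i, rfl⟩, rfl⟩ := exists_pow_smul_of_period hg hq hp hr
    simp only
    rw [smul_smul, ((Commute.refl g).pow_left _).zpow_right i, mul_smul, pow_period_smul]

theorem normal_zpowers_of_forall {g : G}
    (he : ∀ d, d ∣ orderOf g → d + 1 ≤ (zpowers g).index → d = 1) : (zpowers g).Normal := by
  have h := pow_mem_normalCore (e := 1) (mem_zpowers g) fun d h1 h2 => (he d h1 h2).dvd
  rw [pow_one] at h
  exact normal_zpowers_of_mem_normalCore h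

/-- The support has even size, is nonempty, and misses a point of a set with at most four elements:
`σ` is a transposition. -/
theorem sign_of_card_le_four {α : Type*} [Fintype α] [DecidableEq α] (hα : Fintype.card α ≤ 4)
    {σ : Equiv.Perm α} (h1 : σ ≠ 1) (h2 : σ ^ 2 = 1) {a : α} (ha : σ a = a) :
    Equiv.Perm.sign σ = -1 := by
  have h3 := Equiv.Perm.two_dvd_card_support h2
  have h4 : σ.support.card < Fintype.card α :=
    Finset.card_lt_univ_of_notMem (Equiv.Perm.notMem_support.mpr ha)
  have h5 := Equiv.Perm.card_support_le_one.not.mpr h1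
  exact (Equiv.Perm.card_support_eq_two.mp (by omega)).sign_eq

/-- The sign of the permutation of the left cosets of `H`. -/
noncomputable def signCoset (H : Subgroup G) : G →* ℤˣ := by
  classical
  exact letI := Fintype.ofFinite (G ⧸ H); Equiv.Perm.sign.comp (toPermHom G (G ⧸ H))

theorem signCoset_ne_one {H : Subgroup G} (hH : H.index ≤ 4) {g : G} (hg : g ∈ H)
    (h1 : g ∉ H.normalCore) (h2 : g ^ 2 ∈ H.normalCore) : signCoset H g ≠ 1 := by
  classical
  let := Fintype.ofFinite (G ⧸ H)
  rw [normalCore_eq_ker, MonoidHom.mem_ker] at h1 h2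
  rw [map_pow] at h2
  have h := sign_of_card_le_four (by rwa [← Nat.card_eq_fintype_card, ← index_eq_card]) h1 h2
    (a := ((1 : G) : G ⧸ H)) (smul_coe_one_of_mem hg)
  have h' : signCoset H g = -1 := by
    rw [← h]
    unfold signCoset
    rw [MonoidHom.comp_apply]
  rw [h']
  decide

end CyclicSubgroups

/-! ### Tools for elements of small order -/

section SmallCases

open Subgroup MulAction

variable {G : Type*} [Group G]

theorem not_dvd_of_isCoprime {a : ℤ} {n p : ℕ} (hp : p ≠ 1) (hpn : p ∣ n) (h : IsCoprime a n) :
    ¬ (p : ℤ) ∣ a := fun hpa => by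
  have h1 := h.isUnit_of_dvd' hpa (Int.natCast_dvd_natCast.mpr hpn)
  rw [Int.isUnit_iff] at h1
  omega

theorem modEq_one_or_neg_of_isCoprime {d : ℕ} (hd : d ∣ 4 ∨ d ∣ 6) {a : ℤ} (h : IsCoprime a d) :
    a ≡ 1 [ZMOD d] ∨ -a ≡ 1 [ZMOD d] := by
  have hd6 : d ≤ 6 := by
    rcases hd with h | h <;> have := Nat.le_of_dvd (by norm_num) h <;> omega
  have h2 : 2 ∣ d → ¬ (2 : ℤ) ∣ a := fun hh => not_dvd_of_isCoprime (by norm_num) hh h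
  have h3 : 3 ∣ d → ¬ (3 : ℤ) ∣ a := fun hh => not_dvd_of_isCoprime (by norm_num) hh h
  have h3' : 3 ∣ d → a % 3 = 1 ∨ a % 3 = 2 := fun hh => by
    have := h3 hh
    omega
  simp only [Int.ModEq]
  interval_cases d <;> simp at hd h2 h3' ⊢ <;> omega

theorem PowConj.of_neg {g : G} {a : ℤ} (h : PowConj g (-a)) : PowConj g a :=
  h.of_modEq (Or.inr (Int.ModEq.refl _))

theorem powConj_of_orderOf_le {g : G} (hg : orderOf g ∣ 4 ∨ orderOf g ∣ 6) {a : ℤ}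
    (ha : IsCoprime a (orderOf g)) : PowConj g a := by
  rcases modEq_one_or_neg_of_isCoprime hg ha with h | h
  · exact (PowConj.one g).of_modEq (Or.inl h.symm)
  · exact ((PowConj.one g).of_modEq (Or.inl h.symm)).of_neg

/-- The quotient `(ℤ/8)ˣ / {±1}` is generated by `5`. Likewise `4`, `7` and `13` generate it for the
moduli `9`, `12` and `16`, so one exponent settles each of these orders. -/
theorem powConj_of_orderOf_eight {g : G} (hg : orderOf g = 8) (h5 : PowConj g 5) {a : ℤ}
    (ha : IsCoprime a (orderOf g)) : PowConj g a := by
  rw [hg] at ha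
  have h2 : ¬ (2 : ℤ) ∣ a := not_dvd_of_isCoprime (by norm_num) (by norm_num) ha
  by_cases h : a % 8 = 1 ∨ a % 8 = 7
  · refine (PowConj.one g).of_modEq ?_
    simp only [hg, Int.ModEq]
    omega
  · refine h5.of_modEq ?_
    simp only [hg, Int.ModEq]
    omega

theorem powConj_of_orderOf_nine {g : G} (hg : orderOf g = 9) (h4 : PowConj g 4) {a : ℤ}
    (ha : IsCoprime a (orderOf g)) : PowConj g a := by
  rw [hg] at ha
  have h2 : ¬ (3 : ℤ) ∣ a := not_dvd_of_isCoprime (by norm_num) (by norm_num) ha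
  by_cases h : a % 9 = 1 ∨ a % 9 = 8
  · refine (PowConj.one g).of_modEq ?_
    simp only [hg, Int.ModEq]
    omega
  by_cases h' : a % 9 = 4 ∨ a % 9 = 5
  · refine h4.of_modEq ?_
    simp only [hg, Int.ModEq]
    omega
  · refine (h4.pow 2).of_modEq ?_
    simp only [hg, Int.ModEq]
    omega

theorem powConj_of_orderOf_twelve {g : G} (hg : orderOf g = 12) (h7 : PowConj g 7) {a : ℤ}
    (ha : IsCoprime a (orderOf g)) : PowConj g a := by
  rw [hg] at ha
  have h2 : ¬ (2 : ℤ) ∣ a := not_dvd_of_isCoprime (by norm_num) (by norm_num) ha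
  have h3 : ¬ (3 : ℤ) ∣ a := not_dvd_of_isCoprime (by norm_num) (by norm_num) ha
  by_cases h : a % 12 = 1 ∨ a % 12 = 11
  · refine (PowConj.one g).of_modEq ?_
    simp only [hg, Int.ModEq]
    omega
  · refine h7.of_modEq ?_
    have h3' : a % 3 = 1 ∨ a % 3 = 2 := by omega
    simp only [hg, Int.ModEq]
    omega

theorem powConj_of_orderOf_sixteen {g : G} (hg : orderOf g = 16) (h13 : PowConj g 13) {a : ℤ}
    (ha : IsCoprime a (orderOf g)) : PowConj g a := by
  rw [hg] at ha
  have h2 : ¬ (2 : ℤ) ∣ a := not_dvd_of_isCoprime (by norm_num) (by norm_num) ha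
  have h : ∃ j < 4, (13 : ℤ) ^ j ≡ a [ZMOD orderOf g] ∨ (13 : ℤ) ^ j ≡ -a [ZMOD orderOf g] := by
    have h0 : 0 ≤ a % 16 := by omega
    have h1 : a % 16 < 16 := by omega
    simp only [hg, Int.ModEq]
    by_cases h : a % 16 = 1 ∨ a % 16 = 15
    · exact ⟨0, by norm_num, by omega⟩
    by_cases h : a % 16 = 3 ∨ a % 16 = 13
    · exact ⟨1, by norm_num, by omega⟩
    by_cases h : a % 16 = 7 ∨ a % 16 = 9
    · exact ⟨2, by norm_num, by omega⟩
    · exact ⟨3, by norm_num, by omega⟩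
  obtain ⟨j, -, hj⟩ := h
  exact (h13.pow j).of_modEq hj

theorem normal_sylow_of_forall_dvd [Finite G] {p : ℕ} [hp : Fact p.Prime] (P : Sylow p G)
    (h : ∀ d, d ∣ (P : Subgroup G).index → d % p = 1 → d = 1) : (P : Subgroup G).Normal := by
  have h1 := h _ P.card_dvd_index (by
    have := card_sylow_modEq_one p G
    rwa [Nat.ModEq, Nat.mod_eq_of_lt hp.out.one_lt] at this)
  have := (Nat.card_eq_one_iff_unique.mp h1).1
  exact P.normal_of_subsingleton

theorem exists_sylow_of_orderOf [Finite G] {p i j m : ℕ} [hp : Fact p.Prime] {g : G}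
    (hg : orderOf g = p ^ i) (hG : Nat.card G = p ^ j * m) (hm : ¬ p ∣ m) :
    ∃ P : Sylow p G, g ∈ (P : Subgroup G) ∧ Nat.card P = p ^ j ∧ (P : Subgroup G).index = m := by
  have h1 : IsPGroup p (zpowers g) := IsPGroup.of_card (by rw [Nat.card_zpowers, hg])
  obtain ⟨P, hP⟩ := h1.exists_le_sylow
  have hm0 : m ≠ 0 := fun h => hm (h ▸ dvd_zero p)
  have h2 : Nat.card P = p ^ j := by
    rw [P.card_eq_multiplicity, hG, Nat.factorization_mul (pow_ne_zero _ hp.out.ne_zero) hm0,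
      Finsupp.add_apply, Nat.factorization_eq_zero_of_not_dvd hm, hp.out.factorization_pow]
    simp
  refine ⟨P, hP (mem_zpowers g), h2, ?_⟩
  have h3 := (P : Subgroup G).card_mul_index
  rw [hG] at h3
  exact Nat.eq_of_mul_eq_mul_left (pow_pos hp.out.pos j) (h2 ▸ h3)

theorem isMulCommutative_of_card {p j : ℕ} [hp : Fact p.Prime] (hj : j ≤ 2) {P : Type*} [Group P]
    (hP : Nat.card P = p ^ j) : IsMulCommutative P := by
  have : Finite P := Nat.finite_of_card_ne_zero (hP ▸ pow_ne_zero _ hp.out.ne_zero)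
  interval_cases j
  · have := (Nat.card_eq_one_iff_unique.mp (hP.trans (pow_zero p))).1
    exact ⟨⟨fun a b => Subsingleton.elim _ _⟩⟩
  · have := isCyclic_of_prime_card (hP.trans (pow_one p))
    exact ⟨⟨fun a b => IsCyclic.commGroup.mul_comm a b⟩⟩
  · exact IsPGroup.isMulCommutative_of_card_eq_prime_sq hP

theorem le_centralizer_zpowers {g x : G} (hx : x ∈ zpowers g) :
    zpowers g ≤ centralizer (zpowers x : Set G) := by
  rw [le_centralizer_iff, zpowers_le]
  exact fun y hy => (setLike_mul_comm (s := zpowers g) hx hy).symm ▸ rfl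

theorem mem_center_of_centralizer_eq_top {x : G} (h : centralizer (zpowers x : Set G) = ⊤) :
    x ∈ center G :=
  centralizer_eq_top_iff_subset.mp h (mem_zpowers x)

theorem index_center_mul_dvd {x : G} (hx : x ∈ center G) :
    (center G).index * orderOf x ∣ Nat.card G := by
  rw [← (center G).card_mul_index, mul_comm]
  refine mul_dvd_mul_right ?_ _
  rw [← Nat.card_zpowers]
  exact card_dvd_of_le (zpowers_le.mpr hx)

variable [Finite G]

theorem powConj_of_mem_of_gcd_dvd (N : Subgroup G) [N.Normal] [IsMulCommutative N] {g : G}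
    (hg : g ∈ N) {a : ℤ} (ha : IsCoprime a (orderOf g))
    (h : Nat.gcd (orderOf g) N.index ∣ 4 ∨ Nat.gcd (orderOf g) N.index ∣ 6) : PowConj g a :=
  powConj_of_mem N hg ha (modEq_one_or_neg_of_isCoprime h
    (ha.of_isCoprime_of_dvd_right (Int.natCast_dvd_natCast.mpr (Nat.gcd_dvd_left _ _))))

theorem powConj_of_normal {g : G} (hN : (zpowers g).Normal) {a : ℤ}
    (ha : IsCoprime a (orderOf g)) (h : Nat.gcd (orderOf g) (zpowers g).index ∣ 4 ∨
      Nat.gcd (orderOf g) (zpowers g).index ∣ 6) : PowConj g a :=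
  powConj_of_mem_of_gcd_dvd (zpowers g) (mem_zpowers g) ha h

/-- The divisor condition makes the Sylow subgroup normal by Sylow's counting theorem, and it is
abelian because its order divides `p ^ 2`. Its index is prime to the order of `g`. -/
theorem powConj_of_sylow {p i j m : ℕ} [hp : Fact p.Prime] {g : G}
    (hg : orderOf g = p ^ i) (hj : j ≤ 2) (hG : Nat.card G = p ^ j * m) (hm : ¬ p ∣ m)
    (h : ∀ d, d ∣ m → d % p = 1 → d = 1) {a : ℤ} (ha : IsCoprime a (orderOf g)) :
    PowConj g a := by
  obtain ⟨P, hgP, hP, hPm⟩ := exists_sylow_of_orderOf hg hG hm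
  have := isMulCommutative_of_card hj hP
  have := normal_sylow_of_forall_dvd P (hPm ▸ h)
  refine powConj_of_mem_of_gcd_dvd (P : Subgroup G) hgP ha (Or.inl ?_)
  rw [hPm, hg, Nat.Coprime.gcd_eq_one ((Nat.Prime.coprime_iff_not_dvd hp.out).mpr hm |>.pow_left i)]
  exact one_dvd 4

/-- Split `g` into its part of odd order, which lies in `N`, and the involution `g ^ m`; an
automorphism can act as a power map on the first and fix the second. When the greatest common
divisor is `3`, replacing `a` by `-a` gives an exponent that is `1` modulo `3`. -/
theorem powConj_of_orderOf_eq_two_mul (N : Subgroup G) [N.Normal] [IsMulCommutative N]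
    (hN : Odd (Nat.card N)) {g : G} {m : ℕ} (hm : Odd m) (hg : orderOf g = 2 * m)
    (hgN : g ^ 2 ∈ N) (h : Nat.gcd m N.index ∣ 3) {a : ℤ} (ha : IsCoprime a (orderOf g)) :
    PowConj g a := by
  obtain ⟨j, rfl⟩ := hm
  have hx : (g ^ 2) ^ (-j : ℤ) ∈ N := zpow_mem hgN _
  have hxh : (g ^ 2) ^ (-j : ℤ) * g ^ (2 * j + 1) = g := by
    rw [zpow_neg, zpow_natCast, ← pow_mul, pow_succ, inv_mul_cancel_left]
  have hcomm : Commute ((g ^ 2) ^ (-j : ℤ)) (g ^ (2 * j + 1)) :=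
    ((Commute.refl g).pow_pow _ _).zpow_left _
  have hord : orderOf ((g ^ 2) ^ (-j : ℤ)) ∣ 2 * j + 1 := by
    rw [orderOf_dvd_iff_pow_eq_one, ← zpow_natCast, ← zpow_mul, mul_comm, zpow_mul,
      zpow_natCast, ← pow_mul, ← hg, pow_orderOf_eq_one, one_zpow]
  have hh : (g ^ (2 * j + 1)) ^ 2 = 1 := by
    rw [← pow_mul, mul_comm, ← hg, pow_orderOf_eq_one]
  have key : ∀ b : ℤ, IsCoprime b (orderOf g) → b ≡ 1 [ZMOD 3] → PowConj g b := fun b hb hb1 => by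
    rw [hg] at hb
    have hodd : Odd b := by
      rw [← Int.not_even_iff_odd, even_iff_two_dvd]
      exact not_dvd_of_isCoprime (by norm_num) (Dvd.intro _ rfl) hb
    have := powConj_mul_of_mem N hN hx hh hcomm
      (hb.of_isCoprime_of_dvd_right (Int.natCast_dvd_natCast.mpr (hord.mul_left 2))) hodd
      (hb1.of_dvd (Int.natCast_dvd_natCast.mpr ((Nat.gcd_dvd_gcd_of_dvd_left _ hord).trans h)))
    rwa [hxh] at this
  by_cases h3 : Nat.gcd (2 * j + 1) N.index = 1
  · have : ∀ b : ℤ, IsCoprime b (orderOf g) → PowConj g b := fun b hb => by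
      rw [hg] at hb
      have hodd : Odd b := by
        rw [← Int.not_even_iff_odd, even_iff_two_dvd]
        exact not_dvd_of_isCoprime (by norm_num) (Dvd.intro _ rfl) hb
      have := powConj_mul_of_mem N hN hx hh hcomm
        (hb.of_isCoprime_of_dvd_right (Int.natCast_dvd_natCast.mpr (hord.mul_left 2))) hodd
        (Int.modEq_iff_dvd.mpr (by
          have := Nat.gcd_dvd_gcd_of_dvd_left N.index hord
          rw [h3, Nat.dvd_one] at this
          rw [this]
          exact one_dvd _))
      rwa [hxh] at this
    exact this a ha
  · have h3' : 3 ∣ orderOf g := by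
      have := (Nat.dvd_prime Nat.prime_three).mp h
      rw [hg, ← this.resolve_left h3]
      exact (Nat.gcd_dvd_left _ _).mul_left 2
    have h4 := not_dvd_of_isCoprime (by norm_num) h3' ha
    by_cases h5 : a % 3 = 1
    · exact key a ha h5
    · refine (key (-a) ha.neg_left ?_).of_neg
      rw [Int.ModEq]
      omega

theorem powConj_of_sq_mem_normalCore' {g : G} {m : ℕ} (hg : orderOf g = 2 * m) (hm : Odd m)
    (h2 : g ^ 2 ∈ (zpowers g).normalCore) (h : Nat.gcd m (2 * (zpowers g).index) ∣ 3) {a : ℤ}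
    (ha : IsCoprime a (orderOf g)) : PowConj g a := by
  have := normal_zpowers_of_mem_normalCore h2
  have hm0 := hm.pos
  have ho : orderOf (g ^ 2) = m := by
    rw [orderOf_pow, hg, Nat.gcd_mul_right_left, Nat.mul_div_cancel_left _ two_pos]
  have hc : (zpowers (g ^ 2)).index = 2 * (zpowers g).index := by
    have h1 := orderOf_mul_index_zpowers (g ^ 2)
    rw [← orderOf_mul_index_zpowers g, ho, hg, mul_comm 2, mul_assoc] at h1
    exact Nat.eq_of_mul_eq_mul_left hm0 h1
  exact powConj_of_orderOf_eq_two_mul (zpowers (g ^ 2)) (by rwa [Nat.card_zpowers, ho]) hm hg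
    (mem_zpowers _) (hc ▸ h) ha

/-- Here `g` acts on at most four cosets as a nontrivial involution with a fixed point, hence as an
odd permutation; `g ^ (2 * m)` generates a normal subgroup of order two, so it is central. -/
theorem powConj_of_sq_mem_normalCore {g : G} {m : ℕ} (hg : orderOf g = 4 * m)
    (h1 : g ∉ (zpowers g).normalCore) (h2 : g ^ 2 ∈ (zpowers g).normalCore)
    (hi : (zpowers g).index ≤ 4) : PowConj g (1 + 2 * m) := by
  refine powConj_of_sign (signCoset_ne_one hi (mem_zpowers g) h1 h2) hg ?_
  have h3 : g ^ (2 * m) ∈ (zpowers g).normalCore := by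
    rw [pow_mul]
    exact pow_mem h2 m
  have := normal_zpowers_of_mem_normalCore h3
  refine mem_center_of_orderOf_eq_two ?_
  have hm : 0 < m := by have := orderOf_pos g; omega
  rw [orderOf_pow_of_dvd (by omega) (by rw [hg]; exact ⟨2, by ring⟩), hg]
  exact Nat.div_eq_of_eq_mul_left (by omega) (by ring)

theorem eq_top_of_normal_of_period {g : G} {H M : Subgroup G} [hM : M.Normal] (hg : g ∈ H)
    {q : G ⧸ H} (hq : q ≠ ((1 : G) : G ⧸ H)) (hp : period g q + 1 = H.index)
    (hp1 : period g q ≠ 1) (hHM : H ≤ M) : M = ⊤ := by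
  -- This conjugate of `g` lies in `M` by normality, but not in `H`, since `g` moves the coset `q`.
  refine eq_top_of_period hg hq hp hHM (y := q.out⁻¹ * g * q.out) ?_ fun h => hp1 ?_
  · simpa using hM.conj_mem g (hHM hg) q.out⁻¹
  · rw [period_eq_one_iff]
    have h1 : ((q.out : G) : G ⧸ H) = ((g * q.out : G) : G ⧸ H) := by
      rwa [QuotientGroup.eq, ← mul_assoc]
    rw [← smul_eq_mul, ← Quotient.smul_coe, QuotientGroup.out_eq'] at h1
    exact h1.symm

/-- The centralizer of the normal subgroup generated by this power is normal and contains `g`, so by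
maximality it is everything. -/
theorem pow_period_mem_center {g : G} {q : G ⧸ zpowers g} (hq : q ≠ ((1 : G) : G ⧸ zpowers g))
    (hp : period g q + 1 = (zpowers g).index) (hp1 : period g q ≠ 1) :
    g ^ period g q ∈ center G := by
  have := normal_zpowers_of_mem_normalCore (pow_period_mem_normalCore (mem_zpowers g) hq hp)
  exact mem_center_of_centralizer_eq_top (eq_top_of_normal_of_period (mem_zpowers g) hq hp hp1
    (le_centralizer_zpowers (pow_mem (mem_zpowers g) _)))

end SmallCases

/-! ### The Klein four-group inside the symmetric group on four points -/

section PermFinFour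

open Equiv

set_option maxRecDepth 100000 in
/-- The even permutations of four points whose square is trivial. -/
def evenSqTrivial : Subgroup (Perm (Fin 4)) where
  carrier := {σ | Perm.sign σ = 1 ∧ σ ^ 2 = 1}
  one_mem' := by simp
  mul_mem' := by
    have : ∀ a b : Perm (Fin 4), (Perm.sign a = 1 ∧ a ^ 2 = 1) → (Perm.sign b = 1 ∧ b ^ 2 = 1) →
      (Perm.sign (a * b) = 1 ∧ (a * b) ^ 2 = 1) := by decide
    exact fun {a b} => this a b
  inv_mem' := by
    rintro a ⟨h1, h2⟩
    exact ⟨by rw [Perm.sign_inv, h1], by rw [inv_pow, h2, inv_one]⟩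

set_option maxRecDepth 100000 in
theorem card_evenSqTrivial : Nat.card evenSqTrivial = 4 := by
  have : Nat.card evenSqTrivial = Nat.card {σ : Perm (Fin 4) // Perm.sign σ = 1 ∧ σ ^ 2 = 1} := rfl
  rw [this, Nat.card_eq_fintype_card]
  decide

theorem evenSqTrivial_le : evenSqTrivial ≤ alternatingGroup (Fin 4) := fun _ h => h.1

set_option maxRecDepth 100000 in
theorem pow_three_mem_evenSqTrivial :
    ∀ σ ∈ alternatingGroup (Fin 4), σ ^ 3 ∈ evenSqTrivial := by
  have : ∀ σ : Perm (Fin 4), Perm.sign σ = 1 → Perm.sign (σ ^ 3) = 1 ∧ (σ ^ 3) ^ 2 = 1 := by decide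
  exact this

-- A 3-cycle permutes the three double transpositions cyclically, and their product is trivial.
set_option maxRecDepth 100000 in
theorem conj_mul_evenSqTrivial : ∀ σ : Perm (Fin 4), σ ^ 3 = 1 → σ ≠ 1 → ∀ v ∈ evenSqTrivial,
    v * (σ * v * σ⁻¹) * (σ ^ 2 * v * (σ ^ 2)⁻¹) = 1 := by
  have : ∀ σ : Perm (Fin 4), σ ^ 3 = 1 → σ ≠ 1 → ∀ v, (Perm.sign v = 1 ∧ v ^ 2 = 1) →
    v * (σ * v * σ⁻¹) * (σ ^ 2 * v * (σ ^ 2)⁻¹) = 1 := by decide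
  exact fun σ h1 h2 v hv => this σ h1 h2 v hv

theorem mul_comm_of_mem_evenSqTrivial {u v : Perm (Fin 4)} (hu : u ∈ evenSqTrivial)
    (hv : v ∈ evenSqTrivial) : u * v = v * u := by
  have h1 := (evenSqTrivial.mul_mem hu hv).2
  have h2 := hu.2
  have h3 := hv.2
  rw [pow_two] at h1 h2 h3
  rw [eq_inv_of_mul_eq_one_left h1, mul_inv_rev, inv_eq_of_mul_eq_one_left h2,
    inv_eq_of_mul_eq_one_left h3]

end PermFinFour

/-! ### A transfer argument over the alternating group on four points -/

section OrderTwelve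

open Subgroup MulAction

variable {G : Type*} [Group G] [Finite G]

open scoped IsMulCommutative in
/-- A central extension of a subgroup of index three with values in `A₄` by a cyclic group of
order four has a homomorphism onto a group of order two which does not vanish on the center. -/
theorem exists_index_two_of_alternating (φ : G →* Equiv.Perm (Fin 4)) {z g : G}
    (hz : z ∈ center G) (hz4 : orderOf z = 4) (hg : g ^ 3 = z) (hker : φ.ker = zpowers z)
    (hφ : φ.range = alternatingGroup (Fin 4)) (hg1 : φ g ≠ 1) :
    ∃ U : Subgroup G, U.index = 2 ∧ g ∉ U ∧ z ^ 2 ∈ U := by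
  set Q := evenSqTrivial.comap φ with hQdef
  have hzφ : φ z = 1 := by
    rw [← MonoidHom.mem_ker, hker]
    exact mem_zpowers z
  have hzQ : z ∈ Q := by
    rw [hQdef, mem_comap, hzφ]
    exact one_mem _
  have hcen : ∀ i : ℤ, ∀ y : G, y * z ^ i = z ^ i * y := fun i =>
    mem_center_iff.mp (zpow_mem hz i)
  have hQi : Q.index = 3 := by
    rw [hQdef, index_comap, hφ]
    have h1 := card_mul_index (evenSqTrivial.subgroupOf (alternatingGroup (Fin 4)))
    rw [Nat.card_congr (subgroupOfEquivOfLe evenSqTrivial_le).toEquiv, card_evenSqTrivial,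
      nat_card_alternatingGroup, Nat.card_fin] at h1
    change 4 * evenSqTrivial.relIndex _ = _ at h1
    norm_num [Nat.factorial] at h1
    omega
  let N : Subgroup Q := (zpowers (z ^ 2)).subgroupOf Q
  have hN : N.Normal := by
    refine ⟨?_⟩
    rintro ⟨n, hn⟩ hnN ⟨y, hy⟩
    rw [mem_subgroupOf] at hnN ⊢
    obtain ⟨i, rfl⟩ := mem_zpowers_iff.mp hnN
    simp only [Subgroup.coe_mul, Subgroup.coe_inv]
    rw [mem_center_iff.mp (zpow_mem (pow_mem hz 2) i), mul_inv_cancel_right]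
    exact zpow_mem (mem_zpowers (z ^ 2)) i
  have hsq : ∀ c ∈ φ.ker, c ^ 2 = 1 → c ∈ zpowers (z ^ 2) := by
    intro c hc hc2
    rw [hker] at hc
    obtain ⟨i, rfl⟩ := mem_zpowers_iff.mp hc
    have h1 : (orderOf z : ℤ) ∣ i * 2 := by
      rw [orderOf_dvd_iff_zpow_eq_one, zpow_mul]
      exact_mod_cast hc2
    obtain ⟨j, rfl⟩ : (2 : ℤ) ∣ i := by
      rw [hz4] at h1
      push_cast at h1
      omega
    exact ⟨j, by simp only; rw [zpow_mul]; norm_cast⟩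
  -- A commutator `c` in `Q` maps to `1` in the Klein group, so it is central; as `x ^ 2` is central
  -- too, `c ^ 2 = 1`, which puts `c` in `zpowers (z ^ 2)`.
  have hcomm : IsMulCommutative (Q ⧸ N) := by
    refine ⟨⟨fun a b => ?_⟩⟩
    induction a using QuotientGroup.induction_on with
    | H a =>
    induction b using QuotientGroup.induction_on with
    | H b =>
    obtain ⟨x, hx⟩ := a
    obtain ⟨y, hy⟩ := b
    rw [← QuotientGroup.mk_mul, ← QuotientGroup.mk_mul, eq_comm, QuotientGroup.eq,
      mem_subgroupOf]
    simp only [Subgroup.coe_mul, Subgroup.coe_inv, mul_inv_rev]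
    have hx' : φ x ∈ evenSqTrivial := hx
    have hy' : φ y ∈ evenSqTrivial := hy
    set c := x⁻¹ * y⁻¹ * (x * y) with hc
    have hcK : c ∈ φ.ker := by
      rw [MonoidHom.mem_ker, hc, map_mul, map_mul φ x, mul_comm_of_mem_evenSqTrivial hx' hy']
      simp
    have hx2 : x ^ 2 ∈ φ.ker := by
      rw [MonoidHom.mem_ker, map_pow]
      exact hx'.2
    have hcK' := hcK
    rw [hker] at hcK' hx2
    obtain ⟨i, hi⟩ := mem_zpowers_iff.mp hcK'
    obtain ⟨j, hj⟩ := mem_zpowers_iff.mp hx2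
    refine hsq c hcK ?_
    have h1 : x * y = y * x * c := by rw [hc]; group
    have h2 : ∀ w, w * c = c * w := fun w => by rw [← hi, hcen]
    have h3 : y * x ^ 2 = x ^ 2 * y := by rw [← hj, hcen]
    clear_value c
    have h4 : x ^ 2 * y = y * x ^ 2 * c ^ 2 := by
      calc x ^ 2 * y = x * (x * y) := by rw [pow_two, mul_assoc]
        _ = x * (y * x * c) := by rw [← h1]
        _ = (x * y) * x * c := by simp only [mul_assoc]
        _ = (y * x * c) * x * c := by rw [← h1]
        _ = y * x ^ 2 * c ^ 2 := by
          rw [mul_assoc (y * x), ← h2 x]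
          simp only [pow_two, mul_assoc]
    rw [h3] at h4
    exact (mul_eq_left.mp h4.symm)
  let π : Q →* Q ⧸ N := QuotientGroup.mk' N
  -- The kernel of this transfer is the desired subgroup: on the central `z` it is the cube of `ζ`,
  -- hence `ζ` itself, and its image will turn out to be `zpowers ζ`.
  let V : G →* Q ⧸ N := MonoidHom.transfer π
  let ζ : Q ⧸ N := π ⟨z, hzQ⟩
  have hζ2 : ζ ^ 2 = 1 := by
    rw [← map_pow, QuotientGroup.mk'_apply, QuotientGroup.eq_one_iff, mem_subgroupOf]
    exact mem_zpowers (z ^ 2)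
  have hζ1 : ζ ≠ 1 := by
    intro h
    change QuotientGroup.mk' N ⟨z, hzQ⟩ = 1 at h
    rw [QuotientGroup.mk'_apply, QuotientGroup.eq_one_iff, mem_subgroupOf] at h
    have h1 := orderOf_dvd_of_mem_zpowers h
    rw [orderOf_pow, hz4] at h1
    norm_num at h1
  have hVz : V z = ζ := by
    have h1 := MonoidHom.transfer_eq_pow π z fun k y _ => by
      have := hcen k y
      rw [zpow_natCast] at this
      rw [mul_assoc, ← this, inv_mul_cancel_left]
    have h2 : V z = ζ ^ 3 := by
      rw [← map_pow]
      refine h1.trans (congrArg π (Subtype.ext ?_))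
      simp [hQi]
    rw [h2, pow_succ, hζ2, one_mul]
  have hA : Nat.card (Q ⧸ N) = 8 := by
    have h1 := φ.ker.card_mul_index
    rw [index_ker, hφ, hker, Nat.card_zpowers, hz4, nat_card_alternatingGroup, Nat.card_fin,
      ← Q.card_mul_index, hQi] at h1
    have h2 := card_eq_card_quotient_mul_card_subgroup N
    have h3 : Nat.card N = 2 := by
      have : zpowers (z ^ 2) ≤ Q := zpowers_le.mpr (pow_mem hzQ 2)
      rw [Nat.card_congr (subgroupOfEquivOfLe this).toEquiv, Nat.card_zpowers, orderOf_pow, hz4]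
      rfl
    rw [h3] at h2
    norm_num [Nat.factorial] at h1
    omega
  have hcard : ∀ a : Q ⧸ N, a ^ 8 = 1 := fun a => by
    rw [← hA]
    exact pow_card_eq_one'
  -- Cubing twice is the identity on a group of exponent dividing `8`.
  have hcube : ∀ x : G, V x ^ 3 ∈ zpowers ζ → V x ∈ zpowers ζ := fun x hx => by
    have h1 := pow_mem hx 3
    rwa [← pow_mul, pow_succ _ 8, hcard, one_mul] at h1
  have hVQ : ∀ x ∈ Q, V x ∈ zpowers ζ := by
    intro x hx
    apply hcube
    -- The transfer is invariant under conjugation, so it sends this product to `V x ^ 3`; the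
    -- product itself dies in the Klein group.
    have h1 : x * (g * x * g⁻¹) * (g ^ 2 * x * (g ^ 2)⁻¹) ∈ zpowers z := by
      rw [← hker, MonoidHom.mem_ker]
      simp only [map_mul, map_pow, map_inv]
      exact conj_mul_evenSqTrivial (φ g) (by rw [← map_pow, hg, hzφ]) hg1 _ hx
    obtain ⟨i, hi⟩ := mem_zpowers_iff.mp h1
    have h2 := congrArg V hi
    simp only [map_mul, map_zpow, hVz, map_inv] at h2
    rw [mul_comm (V g), mul_inv_cancel_right, mul_comm (V (g ^ 2)), mul_inv_cancel_right] at h2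
    rw [pow_succ, pow_two, ← h2]
    exact zpow_mem (mem_zpowers ζ) i
  have hV : V.range = zpowers ζ := by
    refine le_antisymm ?_ ?_
    · rintro _ ⟨x, rfl⟩
      apply hcube
      rw [← map_pow]
      refine hVQ _ ?_
      rw [hQdef, mem_comap, map_pow]
      exact pow_three_mem_evenSqTrivial _ (hφ ▸ ⟨x, rfl⟩)
    · rw [zpowers_le, ← hVz]
      exact ⟨z, rfl⟩
  refine ⟨V.ker, ?_, fun h => ?_, ?_⟩
  · rw [index_ker, hV, Nat.card_zpowers]
    exact orderOf_eq_prime hζ2 hζ1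
  · apply hζ1
    rw [← hVz, ← hg, map_pow, MonoidHom.mem_ker.mp h, one_pow]
  · rw [MonoidHom.mem_ker, map_pow, hVz, hζ2]

end OrderTwelve

/-! ### Cyclic subgroups of index six -/

section IndexSix

open Subgroup MulAction

variable {G : Type*} [Group G]

/-- Prime relative index makes `zpowers g` maximal in `P`, so the commuting elements `g` and `x`
generate `P`. -/
theorem isMulCommutative_of_relIndex_prime {P : Subgroup G} {g x : G} (hg : zpowers g ≤ P)
    (hp : ((zpowers g).relIndex P).Prime) (hx : x ∈ P) (hxg : x ∉ zpowers g)
    (hcomm : x * g = g * x) : IsMulCommutative P := by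
  have hcl : IsMulCommutative (closure {g, x}) := isMulCommutative_closure (by
    rintro a (rfl | rfl) b (rfl | rfl)
    · rfl
    · exact hcomm.symm
    · exact hcomm
    · rfl)
  have h1 : zpowers g ≤ closure {g, x} :=
    zpowers_le.mpr (subset_closure (Set.mem_insert _ _))
  have h2 : closure {g, x} ≤ P := by
    rw [closure_le]
    rintro a (rfl | rfl)
    · exact hg (mem_zpowers _)
    · exact hx
  have h3 := relIndex_mul_relIndex _ _ _ h1 h2
  rcases (Nat.dvd_prime hp).mp (Dvd.intro _ h3) with h | h
  · exact absurd (relIndex_eq_one.mp h (subset_closure (Set.mem_insert_of_mem _ rfl))) hxg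
  · rw [h] at h3
    have h4 := relIndex_eq_one.mp (Nat.eq_of_mul_eq_mul_left hp.pos (h3.trans (mul_one _).symm))
    rwa [le_antisymm h2 h4] at hcl

theorem conj_pow_three {t c : G} (ht : t ^ 3 = 1) {i : ℤ} (h : t * c * t⁻¹ = c ^ i) :
    c ^ (i ^ 3) = c := by
  have h1 : ∀ j : ℤ, t * c ^ j * t⁻¹ = c ^ (i * j) := fun j => by
    rw [← conj_zpow, h, zpow_mul]
  have h2 := h1 (i * i)
  rw [← h1 i, ← h] at h2
  have h3 : t ^ 3 * c * (t ^ 3)⁻¹ = c ^ (i ^ 3) := by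
    rw [pow_three i, ← h2]
    simp only [pow_succ, pow_zero, one_mul, mul_inv_rev, mul_assoc]
  rw [← h3, ht]
  simp

theorem conj_pow_eq {t c : G} {i : ℤ} (h : t * c * t⁻¹ = c ^ i) (m : ℕ) :
    t ^ m * c * (t ^ m)⁻¹ = c ^ (i ^ m) := by
  induction m with
  | zero => simp
  | succ m ih =>
    rw [pow_succ', mul_inv_rev, mul_assoc, mul_assoc, ← mul_assoc (t ^ m), ← mul_assoc (t ^ m * c),
      ih, ← mul_assoc, ← conj_zpow, h, ← zpow_mul, pow_succ']

theorem powConj_of_conj {x g : G} {j : ℤ} (h : x * g * x⁻¹ = g ^ j) : PowConj g j :=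
  ⟨MulAut.conj x, Or.inl h⟩

theorem conj_mem_of_normal_subgroupOf {C P : Subgroup G} (hCP : C ≤ P) [hN : (C.subgroupOf P).Normal]
    {g y : G} (hg : g ∈ C) (hy : y ∈ P) : y * g * y⁻¹ ∈ C :=
  hN.conj_mem ⟨g, hCP hg⟩ hg ⟨y, hy⟩

variable [Finite G]

theorem mem_normalizer_zpowers {g y : G} (h : y * g * y⁻¹ ∈ zpowers g) :
    y ∈ normalizer (zpowers g : Set G) := by
  refine mem_normalizer_fintype ?_
  rintro _ ⟨i, rfl⟩
  simp only
  rw [← conj_zpow]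
  exact zpow_mem h i

theorem powConj_of_orderOf_nine_of_index_six {g : G} (hg : orderOf g = 9)
    (hi : (zpowers g).index = 6) {a : ℤ} (ha : IsCoprime a (orderOf g)) : PowConj g a := by
  have hG : Nat.card G = 3 ^ 3 * 2 := by rw [← orderOf_mul_index_zpowers g, hg, hi]; norm_num
  obtain ⟨P, hgP, hP, hPi⟩ := exists_sylow_of_orderOf (p := 3) (i := 2) (by rw [hg]; rfl) hG
    (by norm_num)
  have hPN : (P : Subgroup G).Normal := normal_of_index_eq_two hPi
  have hCP : zpowers g ≤ P := zpowers_le.mpr hgP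
  have hr : (zpowers g).relIndex P = 3 := by
    have := relIndex_mul_index hCP
    rw [hPi, hi] at this
    omega
  have hCN : ((zpowers g).subgroupOf P).Normal := normal_of_index_eq_minFac_card (by
    change (zpowers g).relIndex P = _
    rw [hr, hP]
    norm_num)
  obtain ⟨x, hx, hxg⟩ : ∃ x ∈ (P : Subgroup G), x ∉ zpowers g := by
    by_contra! h
    rw [relIndex_eq_one.mpr h] at hr
    omega
  by_cases hcomm : x * g = g * x
  · have := isMulCommutative_of_relIndex_prime hCP (by rw [hr]; exact Nat.prime_three) hx hxg hcomm
    refine powConj_of_mem_of_gcd_dvd (P : Subgroup G) hgP ha (Or.inl ?_)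
    rw [hg, hPi]
    norm_num
  -- Conjugation by `x` raises `g` to a power `j` with `j ^ 27 ≡ 1` modulo `9`, so `j` is `4` or
  -- `7`, and either one yields the exponent `4`.
  · obtain ⟨j, hj⟩ := mem_zpowers_iff.mp (conj_mem_of_normal_subgroupOf hCP (mem_zpowers g) hx)
    have hx27 : x ^ 27 = 1 := by
      have := pow_card_eq_one' (x := (⟨x, hx⟩ : (P : Subgroup G)))
      rw [hP] at this
      exact congrArg Subtype.val this
    have h1 := conj_pow_eq hj.symm 27
    rw [hx27] at h1
    have h2 : (j ^ 27 : ℤ) ≡ 1 [ZMOD 9] := by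
      have : g ^ (j ^ 27) = g ^ (1 : ℤ) := by rw [← h1]; simp
      have := zpow_eq_zpow_iff_modEq.mp this
      rwa [hg] at this
    have h3 : j % 9 = 1 ∨ j % 9 = 4 ∨ j % 9 = 7 := by
      have h4 := ((Int.mod_modEq j 9).pow 27).trans h2
      have h0 : 0 ≤ j % 9 := by omega
      have h9 : j % 9 < 9 := by omega
      rw [Int.ModEq] at h4
      interval_cases j % 9 <;> simp_all
    refine powConj_of_orderOf_nine hg ?_ ha
    have hc := powConj_of_conj hj.symm
    rcases h3 with h3 | h3 | h3
    · refine absurd ?_ hcomm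
      rw [← mul_inv_eq_iff_eq_mul, ← hj]
      have := zpow_eq_of_modEq (g := g) (a := j) (b := 1) (by
        rw [hg, Int.ModEq]
        omega)
      rw [this, zpow_one]
    · refine hc.of_modEq (Or.inl ?_)
      rw [hg, Int.ModEq]
      omega
    · refine (hc.pow 2).of_modEq (Or.inl ?_)
      rw [hg]
      exact (Int.ModEq.pow 2 (show j ≡ 7 [ZMOD 9] from h3)).trans (by decide)

theorem powConj_of_orderOf_eight_of_index_six {g : G} (hg : orderOf g = 8)
    (hi : (zpowers g).index = 6) {a : ℤ} (ha : IsCoprime a (orderOf g)) : PowConj g a := by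
  have hG : Nat.card G = 2 ^ 4 * 3 := by rw [← orderOf_mul_index_zpowers g, hg, hi]; norm_num
  by_cases hCn : (zpowers g).Normal
  · exact powConj_of_normal hCn ha (Or.inl (by rw [hg, hi]; norm_num))
  refine powConj_of_orderOf_eight hg ?_ ha
  obtain ⟨P, hgP, hP, hPi⟩ := exists_sylow_of_orderOf (p := 2) (i := 3) (by rw [hg]; rfl) hG
    (by norm_num)
  have hc : g ^ 4 ∈ center G := by
    have := normal_zpowers_of_mem_normalCore (pow_mem_normalCore (e := 4) (mem_zpowers g) (by
      rw [hg, hi]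
      intro d hd hd6
      have : d ≤ 5 := by omega
      interval_cases d <;> omega))
    refine mem_center_of_orderOf_eq_two ?_
    rw [orderOf_pow, hg]
    norm_num
  by_cases hgc : g ∈ (P : Subgroup G).normalCore
  swap
  · have h2 : g ^ 2 ∈ (P : Subgroup G).normalCore := pow_mem_normalCore hgP (by
      rw [hg, hPi]
      intro d hd hd3
      have : d ≤ 2 := by omega
      interval_cases d <;> omega)
    exact powConj_of_sign (m := 2) (signCoset_ne_one (by omega) hgP hgc h2) (by rw [hg]) hc
  have hCP : zpowers g ≤ P := zpowers_le.mpr hgP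
  have hCO : zpowers g ≤ (P : Subgroup G).normalCore := zpowers_le.mpr hgc
  have hr : (zpowers g).relIndex P = 2 := by
    have := relIndex_mul_index hCP
    rw [hPi, hi] at this
    omega
  -- The core of `P` lies between `zpowers g` and `P`, of relative index two; it is not `zpowers g`,
  -- which is not normal.
  have hPN : (P : Subgroup G).Normal := by
    have h1 := relIndex_mul_relIndex _ _ _ hCO (normalCore_le (P : Subgroup G))
    rw [hr] at h1
    rcases (Nat.dvd_prime Nat.prime_two).mp (Dvd.intro _ h1) with h | h
    · refine absurd ?_ hCn
      rw [le_antisymm hCO (relIndex_eq_one.mp h)]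
      infer_instance
    · rw [h] at h1
      rw [← le_antisymm (normalCore_le (P : Subgroup G)) (relIndex_eq_one.mp (by omega))]
      infer_instance
  have hCN : ((zpowers g).subgroupOf P).Normal := normal_of_index_eq_two hr
  have hsq : ∀ y ∈ (P : Subgroup G), y ^ 2 ∈ zpowers g := fun y hy =>
    Subgroup.sq_mem_of_index_two (H := (zpowers g).subgroupOf P) hr ⟨y, hy⟩
  have hg2 : g ^ 2 ∈ (zpowers g).normalCore := fun y => by
    rw [← conj_pow]
    exact hsq _ (hPN.conj_mem g hgP y)
  have hKN := normal_zpowers_of_mem_normalCore hg2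
  have : Fact (Nat.Prime 3) := ⟨Nat.prime_three⟩
  obtain ⟨t, ht⟩ := exists_prime_orderOf_dvd_card' (G := G) 3 (by rw [hG]; norm_num)
  have ht3 : t ^ 3 = 1 := ht ▸ pow_orderOf_eq_one t
  have hg2o : orderOf (g ^ 2) = 4 := by rw [orderOf_pow, hg]; rfl
  -- The automorphism group of a cyclic group of order four has order two, so an element of order
  -- three acts trivially.
  have htg : t * g ^ 2 * t⁻¹ = g ^ 2 := by
    obtain ⟨i, hi⟩ := mem_zpowers_iff.mp (hKN.conj_mem _ (mem_zpowers _) t)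
    have h1 : (g ^ 2) ^ (i ^ 3) = (g ^ 2) ^ (1 : ℤ) := by rw [conj_pow_three ht3 hi.symm, zpow_one]
    rw [zpow_eq_zpow_iff_modEq, hg2o] at h1
    have h2 : i % 4 = 1 := by
      have h4 := ((Int.mod_modEq i 4).pow 3).trans h1
      have h0 : 0 ≤ i % 4 := by omega
      have h9 : i % 4 < 4 := by omega
      rw [Int.ModEq] at h4
      interval_cases i % 4 <;> simp_all
    rw [← hi, zpow_eq_of_modEq (b := 1) (by rw [hg2o]; exact h2), zpow_one]
  set x := t * g * t⁻¹ with hx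
  have hxP : x ∈ (P : Subgroup G) := hPN.conj_mem g hgP t
  have hx2 : x ^ 2 = g ^ 2 := by rw [hx, conj_pow, htg]
  obtain ⟨j, hj⟩ := mem_zpowers_iff.mp (conj_mem_of_normal_subgroupOf hCP (mem_zpowers g) hxP)
  -- Since `x ^ 2 = g ^ 2`, conjugation by `x` fixes `g ^ 2`, leaving `j` equal to `1` or `5` modulo
  -- `8`. The value `5` is the wanted exponent; the value `1` makes `P` abelian.
  have hj4 : 2 * j % 8 = 2 := by
    have h1 : g ^ (2 * j) = g ^ (2 : ℤ) := by
      have h2 : x * g ^ 2 * x⁻¹ = g ^ 2 := by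
        rw [← hx2, ← pow_succ', pow_succ, mul_inv_cancel_right]
      rw [← conj_pow, ← hj] at h2
      rw [mul_comm, zpow_mul]
      exact_mod_cast h2
    rw [zpow_eq_zpow_iff_modEq, hg] at h1
    exact h1
  by_cases hj5 : j % 8 = 5
  · refine (powConj_of_conj hj.symm).of_modEq (Or.inl ?_)
    rw [hg]
    exact hj5
  have hcomm : x * g = g * x := by
    rw [← mul_inv_eq_iff_eq_mul, ← hj, zpow_eq_of_modEq (b := 1) (by
      rw [hg, Int.ModEq]
      omega), zpow_one]
  -- Otherwise `P` and `t` both normalize `zpowers g`, and together they account for the whole group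
  -- order `48`.
  have hxC : x ∉ zpowers g := fun h => hCn (by
    rw [← normalizer_eq_top_iff]
    have h1 : (P : Subgroup G) ≤ normalizer (zpowers g : Set G) := fun y hy =>
      mem_normalizer_zpowers (conj_mem_of_normal_subgroupOf hCP (mem_zpowers g) hy)
    have h2 : t ∈ normalizer (zpowers g : Set G) := mem_normalizer_zpowers h
    refine eq_top_of_card_eq _ (Nat.dvd_antisymm (card_subgroup_dvd_card _) ?_)
    rw [hG]
    refine Nat.Coprime.mul_dvd_of_dvd_of_dvd (by norm_num) (hP ▸ card_dvd_of_le h1) ?_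
    rw [← ht, ← Nat.card_zpowers]
    exact card_dvd_of_le (zpowers_le.mpr h2))
  have := isMulCommutative_of_relIndex_prime hCP (by rw [hr]; exact Nat.prime_two) hxP hxC hcomm
  have h5 : IsCoprime (5 : ℤ) (orderOf g) := by
    rw [hg]
    exact Nat.isCoprime_iff_coprime.mpr (by norm_num)
  refine powConj_of_mem_of_gcd_dvd (P : Subgroup G) hgP h5 (Or.inl ?_)
  rw [hg, hPi]
  norm_num

theorem powConj_of_orderOf_five_of_index_six {g : G} (hg : orderOf g = 5)
    (hi : (zpowers g).index = 6) {a : ℤ} (ha : IsCoprime a (orderOf g)) : PowConj g a := by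
  classical
  have hG : Nat.card G = 30 := by rw [← orderOf_mul_index_zpowers g, hg, hi]
  by_cases h : ∃ q : G ⧸ zpowers g, q ≠ ((1 : G) : G ⧸ zpowers g) ∧ period g q ≠ 1
  · obtain ⟨q, hq, hp1⟩ := h
    have hp : period g q = 5 := ((Nat.dvd_prime Nat.prime_five).mp
      (hg ▸ period_dvd_orderOf g q)).resolve_left hp1
    have := Fintype.ofFinite G
    let f : G →* ℤˣ := Equiv.Perm.sign.comp (toPermHom G G)
    obtain ⟨t, ht⟩ := exists_prime_orderOf_dvd_card' (G := G) 2 (by rw [hG]; norm_num)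
    have ht2 : t ^ 2 = 1 := ht ▸ pow_orderOf_eq_one t
    -- In the regular representation an involution is a product of fifteen transpositions. The
    -- kernel of the sign is thus a proper normal subgroup containing `g`, contradicting maximality.
    have hft : f t ≠ 1 := by
      have h1 : (toPermHom G G t) ^ 2 = 1 := by rw [← map_pow, ht2, map_one]
      have h2 := Equiv.Perm.sign_of_pow_two_eq_one h1
      have h3 : Fintype.card (Function.fixedPoints (toPermHom G G t)) = 0 := by
        rw [Fintype.card_eq_zero_iff]
        refine ⟨fun ⟨y, hy⟩ => ?_⟩
        have h4 : t * y = y := hy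
        rw [mul_eq_right] at h4
        rw [h4, orderOf_one] at ht
        omega
      rw [h3, ← Nat.card_eq_fintype_card, hG] at h2
      change Equiv.Perm.sign (toPermHom G G t) ≠ 1
      rw [h2]
      decide
    have hgf : f g = 1 := by
      have h1 : f g ^ 5 = 1 := by rw [← map_pow, ← hg, pow_orderOf_eq_one, map_one]
      rcases Int.units_eq_one_or (f g) with h2 | h2
      · exact h2
      · rw [h2] at h1
        exact absurd h1 (by decide)
    have h1 := eq_top_of_normal_of_period (M := f.ker) (mem_zpowers g) hq (by rw [hp, hi]) hp1
      (zpowers_le.mpr hgf)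
    have h2 := index_ker_of_ne_one hft
    rw [h1, index_top] at h2
    omega
  · push Not at h
    have h1 := pow_mem_normalCore_of_period (e := 1) (mem_zpowers g) fun q hq => (h q hq).dvd
    rw [pow_one] at h1
    exact powConj_of_normal (normal_zpowers_of_mem_normalCore h1) ha
      (Or.inl (by rw [hg, hi]; norm_num))

end IndexSix

/-! ### The case analysis up to order fifty-four -/

section Assembly

open Subgroup MulAction

variable {G : Type*} [Group G] [Finite G]

theorem powConj_of_four_dvd_of_sq_mem {g : G} {m : ℕ} (hg : orderOf g = 4 * m)
    (hi : (zpowers g).index ≤ 4) (h2 : g ^ 2 ∈ (zpowers g).normalCore) :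
    (zpowers g).Normal ∨ PowConj g (1 + 2 * m) := by
  by_cases h1 : g ∈ (zpowers g).normalCore
  · exact Or.inl (normal_zpowers_of_mem_normalCore h1)
  · exact Or.inr (powConj_of_sq_mem_normalCore hg h1 h2 hi)

/-- The group has order `48` and acts on the four cosets with kernel generated by the central
element `g ^ 3` and image the alternating group. The transfer then supplies a subgroup of index two
avoiding `g`, and the twist by `g ^ 6` sends `g` to `g ^ 7`. -/
theorem powConj_of_orderOf_twelve_of_period {g : G} (hg : orderOf g = 12)
    (hi : (zpowers g).index = 4) {q : G ⧸ zpowers g} (hq : q ≠ ((1 : G) : G ⧸ zpowers g))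
    (hp : period g q = 3) : PowConj g 7 := by
  have hG : Nat.card G = 48 := by rw [← orderOf_mul_index_zpowers g, hg, hi]
  have hz : g ^ 3 ∈ center G := by
    have := pow_period_mem_center hq (by rw [hp, hi]) (by omega)
    rwa [hp] at this
  have hz4 : orderOf (g ^ 3) = 4 := by rw [orderOf_pow, hg]; rfl
  have e : G ⧸ zpowers g ≃ Fin 4 := Finite.equivFinOfCardEq (by rw [← index_eq_card, hi])
  let φ : G →* Equiv.Perm (Fin 4) := e.permCongrHom.toMonoidHom.comp (toPermHom G (G ⧸ zpowers g))
  have hφker : φ.ker = (zpowers g).normalCore := by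
    rw [normalCore_eq_ker]
    exact MonoidHom.ker_comp_of_injective _ _ e.permCongrHom.injective
  have hzK : zpowers (g ^ 3) ≤ φ.ker := by
    rw [hφker, zpowers_le, ← hp]
    exact pow_period_mem_normalCore (mem_zpowers g) hq (by rw [hp, hi])
  have hg1 : φ g ≠ 1 := fun h => by
    rw [← MonoidHom.mem_ker, hφker, mem_normalCore_iff_smul] at h
    have := period_eq_one_iff.mpr (h q)
    omega
  have hKcard : Nat.card φ.ker = 4 := by
    have h1 : φ.ker ≤ zpowers g := hφker ▸ normalCore_le _
    have h2 := relIndex_mul_relIndex _ _ _ hzK h1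
    have h3 : (zpowers (g ^ 3)).relIndex (zpowers g) = 3 := by
      have h4 := card_mul_index ((zpowers (g ^ 3)).subgroupOf (zpowers g))
      rw [Nat.card_congr (subgroupOfEquivOfLe (hzK.trans h1)).toEquiv, Nat.card_zpowers,
        Nat.card_zpowers, hz4, hg] at h4
      change 4 * (zpowers (g ^ 3)).relIndex (zpowers g) = 12 at h4
      omega
    rw [h3] at h2
    rcases (Nat.dvd_prime Nat.prime_three).mp (Dvd.intro _ h2) with h | h
    · rw [← le_antisymm hzK (relIndex_eq_one.mp h), Nat.card_zpowers, hz4]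
    · rw [h] at h2
      have h5 : φ.ker.relIndex (zpowers g) = 1 := by omega
      exact absurd (relIndex_eq_one.mp h5 (mem_zpowers g)) hg1
  have hker : φ.ker = zpowers (g ^ 3) :=
    (eq_of_le_of_card_ge hzK (by rw [hKcard, Nat.card_zpowers, hz4])).symm
  have hφ : φ.range = alternatingGroup (Fin 4) := by
    apply Equiv.Perm.eq_alternatingGroup_of_index_eq_two
    have h1 := φ.ker.card_mul_index
    rw [index_ker, hKcard, hG] at h1
    have h2 := φ.range.card_mul_index
    have h3 : Nat.card φ.range = 12 := by omega
    rw [Nat.card_perm, Nat.card_fin, h3] at h2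
    norm_num [Nat.factorial] at h2
    omega
  obtain ⟨U, hU, hgU, hzU⟩ := exists_index_two_of_alternating φ hz hz4 rfl hker hφ hg1
  obtain ⟨α, hα⟩ := exists_mulAut_of_index_two U hU (pow_mem hz 2)
    (by rw [← pow_two, ← pow_mul, ← pow_mul]; exact orderOf_dvd_iff_pow_eq_one.mp hg.dvd) hzU
  refine ⟨α, Or.inl ?_⟩
  rw [hα g hgU, ← pow_mul, ← pow_succ']
  norm_cast

theorem powConj_of_orderOf_twelve_of_index_four {g : G} (hg : orderOf g = 12)
    (hi : (zpowers g).index = 4) {a : ℤ} (ha : IsCoprime a (orderOf g)) : PowConj g a := by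
  by_cases h : ∃ q : G ⧸ zpowers g, q ≠ ((1 : G) : G ⧸ zpowers g) ∧ period g q = 3
  · obtain ⟨q, hq, hp⟩ := h
    exact powConj_of_orderOf_twelve hg (powConj_of_orderOf_twelve_of_period hg hi hq hp) ha
  · push Not at h
    have h2 := pow_mem_normalCore_of_period (e := 2) (mem_zpowers g) fun q hq => by
      have h1 := h q hq
      have h3 := period_lt_index (mem_zpowers g) hq
      have h4 := period_dvd_orderOf g q
      rw [hg] at h4
      have h5 : period g q ≤ 3 := by omega
      interval_cases period g q <;> omega
    rcases powConj_of_four_dvd_of_sq_mem (m := 3) hg (by omega) h2 with h | h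
    · exact powConj_of_normal h ha (Or.inl (by rw [hg, hi]; norm_num))
    · exact powConj_of_orderOf_twelve hg h ha

theorem powConj_of_orderOf_sixteen_of_index_three {g : G} (hg : orderOf g = 16)
    (hi : (zpowers g).index = 3) {a : ℤ} (ha : IsCoprime a (orderOf g)) : PowConj g a := by
  have hG : Nat.card G = 48 := by rw [← orderOf_mul_index_zpowers g, hg, hi]
  by_cases hCn : (zpowers g).Normal
  · exact powConj_of_normal hCn ha (Or.inl (by rw [hg, hi]; norm_num))
  have h2 : g ^ 2 ∈ (zpowers g).normalCore := pow_mem_normalCore (mem_zpowers g) (by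
    rw [hg, hi]
    intro d hd hd3
    have : d ≤ 2 := by omega
    interval_cases d <;> omega)
  have := normal_zpowers_of_mem_normalCore h2
  -- The centralizer of `zpowers (g ^ 2)` is normal and contains `zpowers g`, which has prime index
  -- and is not normal.
  have hc : g ^ 2 ∈ center G := by
    apply mem_center_of_centralizer_eq_top
    have hle := le_centralizer_zpowers (pow_mem (mem_zpowers g) 2)
    have h3 := relIndex_mul_index hle
    rw [hi] at h3
    rcases (Nat.dvd_prime Nat.prime_three).mp (Dvd.intro _ h3) with h | h
    · refine absurd ?_ hCn
      rw [le_antisymm hle (relIndex_eq_one.mp h)]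
      infer_instance
    · rw [h] at h3
      exact index_eq_one.mp (by omega)
  have h6 := index_center_mul_dvd hc
  have ho : orderOf (g ^ 2) = 8 := by rw [orderOf_pow, hg]; rfl
  rw [hG, ho] at h6
  refine powConj_of_orderOf_sixteen hg ?_ ha
  -- The index of the center divides `48 / 8 = 6`, and `1 + 2 * 6 = 13`.
  exact powConj_of_center g 2 (m := 6) (Nat.dvd_of_mul_dvd_mul_right (by norm_num : 0 < 8) h6)
    (by rw [hG]; exact Nat.isCoprime_iff_coprime.mpr (by norm_num))

theorem powConj_of_orderOf_nine_of_index_four {g : G} (hg : orderOf g = 9)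
    (hi : (zpowers g).index = 4) {a : ℤ} (ha : IsCoprime a (orderOf g)) : PowConj g a := by
  have hG : Nat.card G = 36 := by rw [← orderOf_mul_index_zpowers g, hg, hi]
  by_cases h : ∃ q : G ⧸ zpowers g, q ≠ ((1 : G) : G ⧸ zpowers g) ∧ period g q = 3
  · obtain ⟨q, hq, hp⟩ := h
    have hz := pow_period_mem_center hq (by rw [hp, hi]) (by omega)
    have h6 := index_center_mul_dvd hz
    have ho : orderOf (g ^ 3) = 3 := by rw [orderOf_pow, hg]; rfl
    rw [hp, hG, ho] at h6
    -- The index of the center divides `36 / 3 = 12`, and `1 + 12 ≡ 4` modulo `9`.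
    refine powConj_of_orderOf_nine hg ((powConj_of_center g 1 (m := 12)
      (Nat.dvd_of_mul_dvd_mul_right (by norm_num : 0 < 3) h6) ?_).of_modEq (Or.inl ?_)) ha
    · rw [hG]
      exact Nat.isCoprime_iff_coprime.mpr (by norm_num)
    · rw [hg]
      decide
  · push Not at h
    have h1 := pow_mem_normalCore_of_period (e := 1) (mem_zpowers g) fun q hq => by
      have h1 := h q hq
      have h3 := period_lt_index (mem_zpowers g) hq
      have h4 := period_dvd_orderOf g q
      rw [hg] at h4
      have h5 : period g q ≤ 3 := by omega
      interval_cases period g q <;> omega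
    rw [pow_one] at h1
    exact powConj_of_normal (normal_zpowers_of_mem_normalCore h1) ha
      (Or.inl (by rw [hg, hi]; norm_num))

theorem powConj_of_orderOf_eight_of_index_five {g : G} (hg : orderOf g = 8)
    (hi : (zpowers g).index = 5) {a : ℤ} (ha : IsCoprime a (orderOf g)) : PowConj g a := by
  have hG : Nat.card G = 40 := by rw [← orderOf_mul_index_zpowers g, hg, hi]
  have ho : orderOf (g ^ 4) = 2 := by rw [orderOf_pow, hg]; rfl
  have := normal_zpowers_of_mem_normalCore (pow_mem_normalCore (e := 4) (mem_zpowers g) (by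
    rw [hg, hi]
    intro d hd hd6
    have : d ≤ 4 := by omega
    interval_cases d <;> omega))
  have h6 := index_center_mul_dvd (mem_center_of_orderOf_eq_two ho)
  rw [hG, ho] at h6
  -- The index of the center divides `40 / 2 = 20`, and `1 + 20 ≡ 5` modulo `8`.
  refine powConj_of_orderOf_eight hg ((powConj_of_center g 1 (m := 20)
    (Nat.dvd_of_mul_dvd_mul_right (by norm_num : 0 < 2) h6) ?_).of_modEq (Or.inl ?_)) ha
  · rw [hG]
    exact Nat.isCoprime_iff_coprime.mpr (by norm_num)
  · rw [hg]
    decide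

theorem powConj_of_index_le_two {g : G} (hi : (zpowers g).index ≤ 2) {a : ℤ}
    (ha : IsCoprime a (orderOf g)) : PowConj g a := by
  have h0 : (zpowers g).index ≠ 0 := FiniteIndex.index_ne_zero
  have hN : (zpowers g).Normal := by
    rcases (by omega : (zpowers g).index = 1 ∨ (zpowers g).index = 2) with h | h
    · rw [index_eq_one.mp h]
      infer_instance
    · exact normal_of_index_eq_two h
  refine powConj_of_normal hN ha (Or.inl ((Nat.gcd_dvd_right _ _).trans ?_))
  interval_cases (zpowers g).index <;> simp_all

theorem powConj_of_four_dvd_of_index_le {g : G} {m : ℕ} (hg : orderOf g = 4 * m)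
    (hm : m = 2 ∨ m = 3) (hi : (zpowers g).index = 3 ∨ (zpowers g).index = 4)
    (h2 : g ^ 2 ∈ (zpowers g).normalCore) {a : ℤ} (ha : IsCoprime a (orderOf g)) :
    PowConj g a := by
  rcases powConj_of_four_dvd_of_sq_mem hg (by omega) h2 with h | h
  · refine powConj_of_normal h ha ?_
    rw [hg]
    rcases hm with rfl | rfl <;> rcases hi with hi | hi <;> rw [hi] <;> norm_num
  · rcases hm with rfl | rfl
    · exact powConj_of_orderOf_eight hg h ha
    · exact powConj_of_orderOf_twelve hg h ha

theorem powConj_of_orderOf_five {g : G} (hg : orderOf g = 5) (hi3 : 3 ≤ (zpowers g).index)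
    (hi : (zpowers g).index ≤ 10) {a : ℤ} (ha : IsCoprime a (orderOf g)) : PowConj g a := by
  have hG := orderOf_mul_index_zpowers g
  have : Fact (Nat.Prime 5) := ⟨Nat.prime_five⟩
  rw [hg] at hG
  generalize hk : (zpowers g).index = k at *
  by_cases h6 : k = 6
  · exact powConj_of_orderOf_five_of_index_six hg (hk.trans h6) ha
  have hs : ∀ j m : ℕ, j ≤ 2 → 5 * k = 5 ^ j * m → ¬ 5 ∣ m → (∀ d, d ∣ m → d % 5 = 1 → d = 1) →
      PowConj g a := fun j m hj h1 h2 h3 =>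
    powConj_of_sylow (p := 5) (i := 1) hg hj (hG.symm.trans h1) h2 h3 ha
  have hd : ∀ m : ℕ, 0 < m → m < 10 → m ≠ 6 → ∀ d, d ∣ m → d % 5 = 1 → d = 1 := by
    intro m h0 hm h6 d hd hd1
    have := Nat.le_of_dvd h0 hd
    have : d = 1 ∨ d = 6 := by omega
    rcases this with rfl | rfl <;> omega
  by_cases h5 : 5 ∣ k
  · obtain ⟨m, rfl⟩ := h5
    exact hs 2 m le_rfl (by ring) (by omega) (hd m (by omega) (by omega) (by omega))
  · exact hs 1 k (by norm_num) (by ring) h5 (hd k (by omega) (by omega) h6)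

theorem powConj_of_orderOf_seven {g : G} (hg : orderOf g = 7) (hi3 : 3 ≤ (zpowers g).index)
    (hi : (zpowers g).index ≤ 7) {a : ℤ} (ha : IsCoprime a (orderOf g)) : PowConj g a := by
  have hG := orderOf_mul_index_zpowers g
  have : Fact (Nat.Prime 7) := ⟨by norm_num⟩
  rw [hg] at hG
  generalize hk : (zpowers g).index = k at *
  have hd : ∀ m : ℕ, 0 < m → m < 7 → ∀ d, d ∣ m → d % 7 = 1 → d = 1 := by
    intro m h0 hm d hd hd1
    have := Nat.le_of_dvd h0 hd
    omega
  by_cases h7 : k = 7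
  · exact powConj_of_sylow (p := 7) (i := 1) (j := 2) (m := 1) hg le_rfl
      (by rw [← hG, h7]; norm_num) (by norm_num) (hd 1 (by norm_num) (by norm_num)) ha
  · exact powConj_of_sylow (p := 7) (i := 1) (j := 1) (m := k) hg (by norm_num)
      (by rw [← hG, pow_one]) (by omega) (hd k (by omega) (by omega)) ha

theorem powConj_of_orderOf_eight_of_index_le {g : G} (hg : orderOf g = 8)
    (hi3 : 3 ≤ (zpowers g).index) (hi : (zpowers g).index ≤ 6) {a : ℤ}
    (ha : IsCoprime a (orderOf g)) : PowConj g a := by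
  rcases (by omega : (zpowers g).index ≤ 4 ∨ (zpowers g).index = 5 ∨ (zpowers g).index = 6)
    with h | h | h
  · refine powConj_of_four_dvd_of_index_le (m := 2) hg (Or.inl rfl) (by omega) ?_ ha
    refine pow_mem_normalCore (mem_zpowers g) fun d hd hd3 => ?_
    rw [hg] at hd
    have : d ≤ 3 := by omega
    interval_cases d <;> omega
  · exact powConj_of_orderOf_eight_of_index_five hg h ha
  · exact powConj_of_orderOf_eight_of_index_six hg h ha

theorem powConj_of_orderOf_nine_of_index_le {g : G} (hg : orderOf g = 9)
    (hi3 : 3 ≤ (zpowers g).index) (hi : (zpowers g).index ≤ 6) {a : ℤ}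
    (ha : IsCoprime a (orderOf g)) : PowConj g a := by
  have : Fact (Nat.Prime 3) := ⟨Nat.prime_three⟩
  rcases (by omega : (zpowers g).index = 3 ∨ (zpowers g).index = 4 ∨ (zpowers g).index = 5 ∨
    (zpowers g).index = 6) with h | h | h | h
  · refine powConj_of_normal (normal_zpowers_of_forall fun d hd hd3 => ?_) ha
      (Or.inr (by rw [hg, h]; norm_num))
    rw [hg] at hd
    have : d ≤ 2 := by omega
    interval_cases d <;> omega
  · exact powConj_of_orderOf_nine_of_index_four hg h ha
  · refine powConj_of_sylow (p := 3) (i := 2) (j := 2) (m := 5) hg le_rfl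
      (by rw [← orderOf_mul_index_zpowers g, hg, h]; norm_num) (by norm_num) (fun d hd hd1 => ?_) ha
    rcases (Nat.dvd_prime Nat.prime_five).mp hd with rfl | rfl <;> omega
  · exact powConj_of_orderOf_nine_of_index_six hg h ha

theorem powConj_of_orderOf_ten {g : G} (hg : orderOf g = 10) (hi3 : 3 ≤ (zpowers g).index)
    (hi : (zpowers g).index ≤ 5) {a : ℤ} (ha : IsCoprime a (orderOf g)) : PowConj g a := by
  have : Fact (Nat.Prime 5) := ⟨Nat.prime_five⟩
  by_cases h : (zpowers g).index = 5
  · have ho : orderOf (g ^ 2) = 5 := by rw [orderOf_pow, hg]; rfl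
    obtain ⟨P, hgP, hP, hPi⟩ := exists_sylow_of_orderOf (p := 5) (i := 1) (j := 2) (m := 2) ho
      (by rw [← orderOf_mul_index_zpowers g, hg, h]; norm_num) (by norm_num)
    have := isMulCommutative_of_card le_rfl hP
    have := normal_of_index_eq_two hPi
    exact powConj_of_orderOf_eq_two_mul (P : Subgroup G) (by rw [hP]; decide) (m := 5)
      (by decide) hg hgP (by rw [hPi]; norm_num) ha
  · refine powConj_of_sq_mem_normalCore' (m := 5) hg (by decide) ?_ ?_ ha
    · refine pow_mem_normalCore (mem_zpowers g) fun d hd hd3 => ?_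
      rw [hg] at hd
      have : d ≤ 3 := by omega
      interval_cases d <;> omega
    · rcases (by omega : (zpowers g).index = 3 ∨ (zpowers g).index = 4) with h | h <;> rw [h] <;>
        norm_num

theorem powConj_of_prime_index_le {g : G} (hp : (orderOf g).Prime)
    (hi0 : (zpowers g).index < orderOf g) {a : ℤ} (ha : IsCoprime a (orderOf g)) :
    PowConj g a := by
  refine powConj_of_normal (normal_zpowers_of_forall fun d hd hdi => ?_) ha (Or.inl ?_)
  · refine ((Nat.dvd_prime hp).mp hd).resolve_right ?_
    omega
  · have h0 : (zpowers g).index ≠ 0 := FiniteIndex.index_ne_zero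
    rw [(Nat.coprime_of_lt_prime h0 hi0 hp).gcd_eq_one]
    exact one_dvd 4

theorem powConj_of_card_le (hG : Nat.card G ≤ 54) (g : G) {a : ℤ}
    (ha : IsCoprime a (orderOf g)) : PowConj g a := by
  rw [← orderOf_mul_index_zpowers g] at hG
  by_cases hi2 : (zpowers g).index ≤ 2
  · exact powConj_of_index_le_two hi2 ha
  have hi3 : 3 ≤ (zpowers g).index := by omega
  -- Order times index is at most `54` and the index is at least `3`.
  have hn : orderOf g ≤ 18 := by nlinarith
  have hn0 := orderOf_pos g
  have hsq : ∀ m : ℕ, 7 ≤ m → Odd m → orderOf g = 2 * m → (zpowers g).index = 3 →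
      Nat.gcd m 6 ∣ 3 → PowConj g a := fun m hm hodd hg h3 hgcd => by
    refine powConj_of_sq_mem_normalCore' hg hodd ?_ (by rwa [h3]) ha
    refine pow_mem_normalCore (mem_zpowers g) fun d _ hd3 => ?_
    have : d ≤ 2 := by omega
    interval_cases d <;> omega
  generalize hg : orderOf g = n at hG hn hn0
  interval_cases n
  · exact powConj_of_orderOf_le (by rw [hg]; norm_num) ha
  · exact powConj_of_orderOf_le (by rw [hg]; norm_num) ha
  · exact powConj_of_orderOf_le (by rw [hg]; norm_num) ha
  · exact powConj_of_orderOf_le (by rw [hg]; norm_num) ha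
  · exact powConj_of_orderOf_five hg hi3 (by omega) ha
  · exact powConj_of_orderOf_le (by rw [hg]; norm_num) ha
  · exact powConj_of_orderOf_seven hg hi3 (by omega) ha
  · exact powConj_of_orderOf_eight_of_index_le hg hi3 (by omega) ha
  · exact powConj_of_orderOf_nine_of_index_le hg hi3 (by omega) ha
  · exact powConj_of_orderOf_ten hg hi3 (by omega) ha
  · exact powConj_of_prime_index_le (by rw [hg]; norm_num) (by omega) ha
  · by_cases h3 : (zpowers g).index = 3
    · refine powConj_of_four_dvd_of_index_le (m := 3) hg (Or.inr rfl) (Or.inl h3) ?_ ha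
      refine pow_mem_normalCore (mem_zpowers g) fun d _ hd3 => ?_
      have : d ≤ 2 := by omega
      interval_cases d <;> omega
    · exact powConj_of_orderOf_twelve_of_index_four hg (by omega) ha
  · exact powConj_of_prime_index_le (by rw [hg]; norm_num) (by omega) ha
  · exact hsq 7 le_rfl (by decide) hg (by omega) (by norm_num)
  · have h3 : (zpowers g).index = 3 := by omega
    refine powConj_of_normal (normal_zpowers_of_forall fun d hd hd3 => ?_) ha
      (Or.inr (by rw [hg, h3]; norm_num))
    rw [hg] at hd
    have : d ≤ 2 := by omega
    interval_cases d <;> omega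
  · exact powConj_of_orderOf_sixteen_of_index_three hg (by omega) ha
  · exact powConj_of_prime_index_le (by rw [hg]; norm_num) (by omega) ha
  · exact hsq 9 (by norm_num) (by decide) hg (by omega) (by norm_num)

theorem conjClassDefect_eq_zero_of_card_le (hG : Nat.card G ≤ 54) : conjClassDefect G = 0 :=
  conjClassDefect_eq_zero fun g _ ha => powConj_of_card_le hG g ha

theorem conjClassDefect_eq_zero_of_comm (h : ∀ x y : G, x * y = y * x) :
    conjClassDefect G = 0 := by
  have : IsMulCommutative (⊤ : Subgroup G) := ⟨⟨fun x y => Subtype.ext (h x y)⟩⟩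
  refine conjClassDefect_eq_zero fun g a ha => powConj_of_mem_of_gcd_dvd ⊤ (mem_top g) ha ?_
  rw [index_top, Nat.gcd_one_right]
  exact Or.inl (one_dvd 4)

end Assembly

/-! ### The nonabelian group of order fifty-five -/

section OrderFiftyFive

open Subgroup MulAction

/-- The generator of order five of the automorphism group of the cyclic group of order eleven
that raises to the third power. -/
def cubeAut : MulAut (Multiplicative (ZMod 11)) where
  toFun a := a ^ 3
  -- `3 * 4 = 12` is `1` modulo `11`.
  invFun a := a ^ 4
  left_inv := by decide
  right_inv := by decide
  map_mul' a b := mul_pow a b 3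

theorem mem_zpowers_ofAdd_one {n : ℕ} (a : Multiplicative (ZMod n)) :
    a ∈ zpowers (Multiplicative.ofAdd (1 : ZMod n)) := by
  obtain ⟨i, hi⟩ := ZMod.intCast_surjective a.toAdd
  refine ⟨i, Multiplicative.toAdd.injective ?_⟩
  rw [← hi]
  simp

theorem orderOf_ofAdd_one (n : ℕ) : orderOf (Multiplicative.ofAdd (1 : ZMod n)) = n := by
  rw [orderOf_ofAdd_eq_addOrderOf, ZMod.addOrderOf_one]

theorem orderOf_cubeAut_dvd :
    orderOf cubeAut ∣ orderOf (Multiplicative.ofAdd (1 : ZMod 5)) := by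
  rw [orderOf_ofAdd_one, orderOf_dvd_iff_pow_eq_one]
  ext a
  revert a
  decide

/-- The action of the cyclic group of order five on the cyclic group of order eleven. -/
noncomputable def cubeAction : Multiplicative (ZMod 5) →* MulAut (Multiplicative (ZMod 11)) :=
  monoidHomOfForallMemZpowers mem_zpowers_ofAdd_one orderOf_cubeAut_dvd

/-- The nonabelian group of order fifty-five. -/
abbrev CyclicSemidirect := SemidirectProduct (Multiplicative (ZMod 11)) (Multiplicative (ZMod 5))
  cubeAction

theorem cubeAction_ofAdd_one : cubeAction (Multiplicative.ofAdd 1) = cubeAut :=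
  monoidHomOfForallMemZpowers_apply_gen _ _

instance : Finite CyclicSemidirect := Finite.of_equiv _ SemidirectProduct.equivProd.symm

theorem card_cyclicSemidirect : Nat.card CyclicSemidirect = 55 := by
  rw [SemidirectProduct.card]
  simp

/-- Generators of a nonabelian group of order fifty-five. -/
structure IsFrobeniusPair {G : Type*} [Group G] (x y : G) : Prop where
  orderOf_left : orderOf x = 11
  orderOf_right : orderOf y = 5
  conj : y * x * y⁻¹ = x ^ (3 : ℤ)

theorem IsFrobeniusPair.map {G H : Type*} [Group G] [Group H] (e : G ≃* H) {x y : G}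
    (h : IsFrobeniusPair x y) : IsFrobeniusPair (e x) (e y) :=
  ⟨by rw [MulEquiv.orderOf_eq, h.orderOf_left], by rw [MulEquiv.orderOf_eq, h.orderOf_right],
    by rw [← map_inv, ← map_mul, ← map_mul, h.conj, map_zpow]⟩

theorem isFrobeniusPair_cyclicSemidirect :
    IsFrobeniusPair (SemidirectProduct.inl (Multiplicative.ofAdd 1) : CyclicSemidirect)
      (SemidirectProduct.inr (Multiplicative.ofAdd 1)) where
  orderOf_left := by
    rw [orderOf_injective _ SemidirectProduct.inl_injective, orderOf_ofAdd_one]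
  orderOf_right := by
    rw [orderOf_injective _ SemidirectProduct.inr_injective, orderOf_ofAdd_one]
  conj := by
    rw [← map_inv, ← SemidirectProduct.inl_aut, cubeAction_ofAdd_one, ← map_zpow]
    rfl

theorem IsFrobeniusPair.not_commute {G : Type*} [Group G] {x y : G} (h : IsFrobeniusPair x y) :
    y * x ≠ x * y := fun hc => by
  have h1 := h.conj
  rw [hc, mul_inv_cancel_right] at h1
  have h2 : x ^ (1 : ℤ) = x ^ (3 : ℤ) := by rwa [zpow_one]
  rw [zpow_eq_zpow_iff_modEq, h.orderOf_left] at h2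
  exact absurd h2 (by decide)

theorem IsFrobeniusPair.nonempty_mulEquiv {G : Type*} [Group G] [Finite G]
    (hG : Nat.card G = 55) {x y : G} (h : IsFrobeniusPair x y) :
    Nonempty (CyclicSemidirect ≃* G) := by
  let f₁ : Multiplicative (ZMod 11) →* G := monoidHomOfForallMemZpowers mem_zpowers_ofAdd_one
    (by rw [h.orderOf_left, orderOf_ofAdd_one] : orderOf x ∣ _)
  let f₂ : Multiplicative (ZMod 5) →* G := monoidHomOfForallMemZpowers mem_zpowers_ofAdd_one
    (by rw [h.orderOf_right, orderOf_ofAdd_one] : orderOf y ∣ _)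
  have hf₁ : f₁ (Multiplicative.ofAdd 1) = x := monoidHomOfForallMemZpowers_apply_gen _ _
  have hf₂ : f₂ (Multiplicative.ofAdd 1) = y := monoidHomOfForallMemZpowers_apply_gen _ _
  have hcube : ∀ n, f₁ (cubeAut n) = y * f₁ n * y⁻¹ := fun n => by
    obtain ⟨i, rfl⟩ := mem_zpowers_ofAdd_one n
    simp only [map_zpow, hf₁]
    rw [← conj_zpow, h.conj]
    change (f₁ (Multiplicative.ofAdd 1 ^ 3)) ^ i = _
    rw [map_pow, hf₁]
    norm_cast
  have hpow : ∀ (j : ℕ) n, f₁ ((cubeAut ^ j) n) = y ^ j * f₁ n * (y ^ j)⁻¹ := fun j => by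
    induction j with
    | zero => simp
    | succ j ih =>
      intro n
      rw [pow_succ', MulAut.mul_apply, hcube, ih, pow_succ']
      simp only [mul_inv_rev, mul_assoc]
  let f : CyclicSemidirect →* G := SemidirectProduct.lift f₁ f₂ fun b => by
    obtain ⟨j, rfl⟩ := (isOfFinOrder_of_finite _).mem_powers_iff_mem_zpowers.mpr
      (mem_zpowers_ofAdd_one b)
    ext n
    simp only [map_pow, cubeAction_ofAdd_one, hf₂]
    rw [← map_pow]
    exact hpow j _
  have hfx : x ∈ f.range := ⟨SemidirectProduct.inl (Multiplicative.ofAdd 1), by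
    rw [SemidirectProduct.lift_inl, hf₁]⟩
  have hfy : y ∈ f.range := ⟨SemidirectProduct.inr (Multiplicative.ofAdd 1), by
    rw [SemidirectProduct.lift_inr, hf₂]⟩
  have hsurj : Function.Surjective f := by
    rw [← MonoidHom.range_eq_top]
    refine eq_top_of_card_eq _ (Nat.dvd_antisymm (card_subgroup_dvd_card _) ?_)
    rw [hG]
    refine Nat.Coprime.mul_dvd_of_dvd_of_dvd (by norm_num : Nat.Coprime 11 5) ?_ ?_
    · exact h.orderOf_left.symm.dvd.trans (orderOf_dvd_natCard f.range hfx)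
    · exact h.orderOf_right.symm.dvd.trans (orderOf_dvd_natCard f.range hfy)
  exact ⟨MulEquiv.ofBijective f ((Nat.bijective_iff_surjective_and_card f).mpr
    ⟨hsurj, by rw [card_cyclicSemidirect, hG]⟩)⟩

theorem normal_zpowers_of_card_eq_fifty_five {G : Type*} [Group G] [Finite G]
    (hG : Nat.card G = 55) {x : G} (hx : orderOf x = 11) :
    (zpowers x).index = 5 ∧ (zpowers x).Normal := by
  have hi : (zpowers x).index = 5 := by
    have := orderOf_mul_index_zpowers x
    rw [hx, hG] at this
    omega
  refine ⟨hi, normal_zpowers_of_forall fun d hd hdi => ?_⟩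
  rw [hx] at hd
  rw [hi] at hdi
  exact ((Nat.dvd_prime (by norm_num)).mp hd).resolve_right (by omega)

theorem exists_isFrobeniusPair {G : Type*} [Group G] [Finite G]
    (hG : Nat.card G = 55) (hnc : ∃ a b : G, a * b ≠ b * a) :
    ∃ x y : G, IsFrobeniusPair x y := by
  have : Fact (Nat.Prime 11) := ⟨by norm_num⟩
  have : Fact (Nat.Prime 5) := ⟨by norm_num⟩
  obtain ⟨x, hx⟩ := exists_prime_orderOf_dvd_card' (G := G) 11 (by rw [hG]; norm_num)
  obtain ⟨y, hy⟩ := exists_prime_orderOf_dvd_card' (G := G) 5 (by rw [hG]; norm_num)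
  obtain ⟨hi, hN⟩ := normal_zpowers_of_card_eq_fifty_five hG hx
  obtain ⟨i, hi'⟩ := mem_zpowers_iff.mp (hN.conj_mem x (mem_zpowers x) y)
  have hpow := conj_pow_eq hi'.symm
  have h5 : i ^ 5 ≡ 1 [ZMOD 11] := by
    have h1 := hpow 5
    rw [← hy, pow_orderOf_eq_one, hy, inv_one, one_mul, mul_one] at h1
    have h2 : x ^ (i ^ 5) = x ^ (1 : ℤ) := by rw [← h1, zpow_one]
    rwa [zpow_eq_zpow_iff_modEq, hx] at h2
  have hyx : y ∉ zpowers x := fun h => by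
    have := orderOf_dvd_of_mem_zpowers h
    rw [hx, hy] at this
    omega
  have h1 : i % 11 ≠ 1 := fun h => by
    have h2 : y * x = x * y := by
      rw [← mul_inv_eq_iff_eq_mul, ← hi', zpow_eq_of_modEq (b := 1) (by rw [hx]; exact h), zpow_one]
    have h3 := isMulCommutative_of_relIndex_prime (P := ⊤) le_top
      (by rw [relIndex_top_right, hi]; norm_num) (mem_top y) hyx h2
    obtain ⟨a, b, hab⟩ := hnc
    exact hab (setLike_mul_comm (mem_top a) (mem_top b))
  -- The exponent `i` has order five modulo `11`, so some power of it is `3`; the matching power of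
  -- `y` is the second generator.
  have key : ∀ m : ℕ, Nat.Coprime 5 m → i ^ m ≡ 3 [ZMOD 11] → ∃ x y : G, IsFrobeniusPair x y :=
    fun m hm h => ⟨x, y ^ m, hx, by rw [Nat.Coprime.orderOf_pow (hy.symm ▸ hm), hy],
      by rw [hpow, zpow_eq_of_modEq (b := 3) (by rwa [hx])]⟩
  have hmod := fun m => (Int.mod_modEq i 11).pow m
  have h4 := (hmod 5).trans h5
  have h0 : 0 ≤ i % 11 := by omega
  have h11 : i % 11 < 11 := by omega
  generalize i % 11 = r at *
  interval_cases r <;> try exact absurd h4 (by decide)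
  · exact absurd rfl h1
  · exact key 1 (by norm_num) ((hmod 1).symm.trans (by decide))
  · exact key 4 (by norm_num) ((hmod 4).symm.trans (by decide))
  · exact key 2 (by norm_num) ((hmod 2).symm.trans (by decide))
  · exact key 3 (by norm_num) ((hmod 3).symm.trans (by decide))

/-- Applying `α` to the relation `y * x * y⁻¹ = x ^ 3` shows that `α y` also cubes the subgroup of
order eleven, whereas `y ^ m` acts on it with exponent `3 ^ m`. -/
theorem IsFrobeniusPair.apply_ne {G : Type*} [Group G] [Finite G] (hG : Nat.card G = 55) {x y : G}
    (h : IsFrobeniusPair x y) (α : MulAut G) {m : ℕ} (hm : ¬ (3 : ℤ) ^ m ≡ 3 [ZMOD 11]) :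
    α y ≠ y ^ m := fun hy => by
  obtain ⟨hi, hN⟩ := normal_zpowers_of_card_eq_fifty_five hG h.orderOf_left
  have hαo : orderOf (α x) = 11 := by rw [MulEquiv.orderOf_eq, h.orderOf_left]
  have h1 : α x ∈ zpowers x := by
    -- Fifth powers lie in the normal subgroup of index five, and `45 ≡ 1` modulo `11` recovers `α
    -- x` from its fifth power.
    have h2 := pow_mem (pow_index_mem (H := zpowers x) (α x)) 9
    rw [hi, ← pow_mul, show 5 * 9 = 11 * 4 + 1 from rfl, pow_succ, pow_mul, ← hαo,
      pow_orderOf_eq_one, one_pow, one_mul] at h2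
    exact h2
  obtain ⟨b, hb⟩ := mem_zpowers_iff.mp h1
  have h3 := congrArg α h.conj
  rw [map_mul, map_mul, map_inv, map_zpow, hy, ← hb, ← conj_zpow, conj_pow_eq h.conj, zpow_comm,
    hb, zpow_eq_zpow_iff_modEq, hαo] at h3
  exact hm h3

theorem IsFrobeniusPair.conjClassDefect_pos {G : Type*} [Group G] [Finite G]
    (hG : Nat.card G = 55) {x y : G} (h : IsFrobeniusPair x y) : 0 < conjClassDefect G := by
  have ho : orderOf (y ^ 2) = orderOf y := Nat.Coprime.orderOf_pow (by
    rw [h.orderOf_right]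
    norm_num)
  refine _root_.conjClassDefect_pos (g := y ^ 2) (h := y)
    ⟨ho, 2, isGaloisExponent_rat (by rw [h.orderOf_right]; norm_num) ?_, 1, trivial, ?_⟩ ?_
  · rw [h.orderOf_right]
    exact Nat.isCoprime_iff_coprime.mpr (by norm_num)
  · rw [MulAut.one_apply]
    norm_cast
  · rintro ⟨-, a, ha, α, -, hα⟩
    rw [h.orderOf_right] at ha
    -- The real exponents `1` and `-1` would give `α y = y ^ 2` and `α y = y ^ 3`, but `3 ^ 2` and
    -- `3 ^ 3` are `9` and `5` modulo `11`.
    rcases ha.real_five with ha | ha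
    · refine h.apply_ne hG α (m := 2) (by decide) ?_
      rw [hα, zpow_eq_of_modEq (b := 1), zpow_one]
      rw [h.orderOf_right]
      exact (Int.modEq_iff_dvd.mpr ha).symm
    · refine h.apply_ne hG α (m := 3) (by decide) ?_
      have h1 : α y ^ (-1 : ℤ) = y ^ 2 := by
        rw [hα, ← map_zpow, zpow_eq_of_modEq]
        rw [h.orderOf_right]
        refine Int.modEq_iff_dvd.mpr ?_
        simpa using ha
      have h2 : y ^ 5 = 1 := h.orderOf_right ▸ pow_orderOf_eq_one y
      rw [zpow_neg_one, inv_eq_iff_eq_inv] at h1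
      rw [h1, inv_eq_iff_mul_eq_one, ← pow_add, h2]

end OrderFiftyFive

/-! ### The main theorem -/

theorem mainTheorem5 :
    (∀ (G : Type u) [Group G] [Finite G], Nat.card G ≤ 54 → conjClassDefect G = 0) ∧
    ∃ (G : Type u) (_ : Group G) (_ : Finite G),
      Nat.card G = 55 ∧ (∃ x y : G, x * y ≠ y * x) ∧
      (∀ (H : Type u) [Group H] [Finite H],
        Nat.card H = 55 → (∃ x y : H, x * y ≠ y * x) → Nonempty (H ≃* G)) ∧
      0 < conjClassDefect G ∧
      ∀ (H : Type u) [Group H] [Finite H], 0 < conjClassDefect H →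
        55 ≤ Nat.card H ∧ (Nat.card H = 55 → Nonempty (H ≃* G)) := by
  have hpair := isFrobeniusPair_cyclicSemidirect.map MulEquiv.ulift.{_, u}.symm
  have hcard : Nat.card (ULift.{u} CyclicSemidirect) = 55 := by
    rw [Nat.card_ulift, card_cyclicSemidirect]
  have huniq : ∀ (H : Type u) [Group H] [Finite H], Nat.card H = 55 →
      (∃ x y : H, x * y ≠ y * x) → Nonempty (H ≃* ULift.{u} CyclicSemidirect) := by
    intro H _ _ hH hnc
    obtain ⟨x, y, hxy⟩ := exists_isFrobeniusPair hH hnc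
    obtain ⟨e⟩ := hxy.nonempty_mulEquiv hH
    exact ⟨e.symm.trans MulEquiv.ulift.symm⟩
  refine ⟨fun G _ _ hG => conjClassDefect_eq_zero_of_card_le hG, ULift.{u} CyclicSemidirect,
    inferInstance, inferInstance, hcard, ⟨_, _, hpair.not_commute⟩, huniq,
    hpair.conjClassDefect_pos hcard, fun H _ _ hH => ⟨?_, fun hH55 => huniq H hH55 ?_⟩⟩
  · by_contra hlt
    rw [conjClassDefect_eq_zero_of_card_le (by omega)] at hH
    exact lt_irrefl _ hH
  · by_contra! hc
    rw [conjClassDefect_eq_zero_of_comm hc] at hH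
    exact lt_irrefl _ hH
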